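/- Let $k$ be any field and $\bar k$ an algebraic closure of $k$. A \emph{self-correspondence} over $\mathbb P^1_k$ is a smooth proper $k$-scheme $D$, every connected component of which is a geometrically irreducible curve, together with two $k$-morphisms $\pi_1,\pi_2 : D \to \mathbb P^1_k$ that are non-constant and separable on every connected component of $D$. For $z \in D(\bar k)$ let $e_{i,z}$ be the ramification index at $z$ of (the base change to $\bar k$ of) $\pi_i$. A subset $S \subset \mathbb P^1(\bar k)$ is \emph{complete} if $\pi_1^{-1}(S)=\pi_2^{-1}(S)$ in $D(\bar k)$; it is an \emph{irreducible complete set} if it is minimal among the non-empty complete sets; it is \emph{equiramified} if $e_{1,z}=e_{2,z}$ for every $z\in D(\bar k)$ with $\pi_1(z)\in S$ and $\pi_2(z) \in S$. The self-correspondence is \emph{finitary} if there is an integer $M$ such that every irreducible complete set is finite of cardinality at most $M$. \textbf{Proposition.} Let $D$ be a self-correspondence over $\mathbb P^1_k$ which is not finitary. Then there are at most two irreducible finite equiramified complete sets. If there are two of them, $S \neq S'$, then every irreducible finite complete set (equiramified or not) is equal to $S$ or to $S'$. -/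

import Mathlib

universe u

open CategoryTheory CategoryTheory.Limits AlgebraicGeometry

noncomputable section

namespace SelfCorr

/-- The spectrum of a field. -/
abbrev SpecOf (k : Type u) [Field k] : Scheme.{u} := Spec (CommRingCat.of k)

/-- The morphism `Spec K ⟶ Spec k` given by a field extension `k → K`. -/
abbrev specMap (k : Type u) [Field k] (K : Type u) [Field K] [Algebra k K] :
    SpecOf K ⟶ SpecOf k :=
  Spec.map (CommRingCat.ofHom (algebraMap k K))

/-- The projective line over `k`: `Proj k[X₀, X₁]` with the standard grading. -/
abbrev projectiveLine (k : Type u) [Field k] : Scheme.{u} :=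
  letI := MvPolynomial.gradedAlgebra (σ := Fin 2) (R := k)
  Proj (MvPolynomial.homogeneousSubmodule (Fin 2) k)

/-- The structure morphism of the projective line over `k`. -/
def projectiveLineToSpec (k : Type u) [Field k] : projectiveLine k ⟶ SpecOf k :=
  letI := MvPolynomial.gradedAlgebra (σ := Fin 2) (R := k)
  Proj.toSpecZero (MvPolynomial.homogeneousSubmodule (Fin 2) k) ≫
    Spec.map (CommRingCat.ofHom (algebraMap k (MvPolynomial.homogeneousSubmodule (Fin 2) k 0)))

/-- A morphism from (a component of) a smooth curve to a smooth curve is *non-constant and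
separable* if it is dominant and induces a separable extension of function fields. The function
field of the source is the residue field at its generic point. -/
structure IsNonconstantSeparable {X Y : Scheme.{u}} (f : X ⟶ Y) : Prop where
  isDominant : IsDominant f
  isSeparable : ∀ η : X, closure {η} = Set.univ →
    letI := (f.residueFieldMap η).hom.toAlgebra
    Algebra.IsSeparable (Y.residueField (f η)) (X.residueField η)

end SelfCorr

open SelfCorr in
/-- A self-correspondence on a curve `C` over `k` with structure morphism `c`: a smooth proper
`k`-scheme `D` with structure morphism `d`, each connected component of which is a geometrically
irreducible curve, with two `k`-morphisms `π₁ π₂ : D ⟶ C` which are non-constant and separable on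
every connected component of `D`. -/
structure SelfCorrespondence {k : Type u} [Field k] {C : Scheme.{u}} (c : C ⟶ SpecOf k) where
  D : Scheme.{u}
  d : D ⟶ SpecOf k
  π₁ : D ⟶ C
  π₂ : D ⟶ C
  π₁_comp : π₁ ≫ c = d
  π₂_comp : π₂ ≫ c = d
  isProper : IsProper d
  smooth : SmoothOfRelativeDimension 1 d
  component : ∀ x : D, ∃ U : D.Opens, (U : Set D) = connectedComponent x ∧
    GeometricallyIrreducible (U.ι ≫ d) ∧
    IsNonconstantSeparable (U.ι ≫ π₁) ∧
    IsNonconstantSeparable (U.ι ≫ π₂)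

namespace SelfCorr

variable {k : Type u} [Field k] (K : Type u) [Field K] [Algebra k K]
  {X Y : Scheme.{u}}

/-- The set `X(K)` of `K`-points of a `k`-scheme: morphisms of `k`-schemes `Spec K ⟶ X`. -/
abbrev Points (x : X ⟶ SpecOf k) : Type u :=
  {z : SpecOf K ⟶ X // z ≫ x = specMap k K}

/-- The base change `X_K` of a `k`-scheme `X` to `K`. -/
abbrev baseChange (x : X ⟶ SpecOf k) : Scheme.{u} := pullback x (specMap k K)

/-- The base change `X_K ⟶ Y_K` of a `k`-morphism `X ⟶ Y`. -/
def baseChangeMap {x : X ⟶ SpecOf k} {y : Y ⟶ SpecOf k} (f : X ⟶ Y) (hf : f ≫ y = x) :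
    baseChange K x ⟶ baseChange K y :=
  pullback.lift (pullback.fst x (specMap k K) ≫ f) (pullback.snd x (specMap k K))
    (by rw [Category.assoc, hf, pullback.condition])

variable {K}

/-- The map `X(K) → Y(K)` induced by a `k`-morphism `X ⟶ Y`. -/
def Points.map {x : X ⟶ SpecOf k} {y : Y ⟶ SpecOf k} (f : X ⟶ Y) (hf : f ≫ y = x)
    (z : Points K x) : Points K y :=
  ⟨z.1 ≫ f, by rw [Category.assoc, hf, z.2]⟩

/-- The section `Spec K ⟶ X_K` given by a `K`-point of `X`. -/
def Points.lift {x : X ⟶ SpecOf k} (z : Points K x) : SpecOf K ⟶ baseChange K x :=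
  pullback.lift z.1 (𝟙 (SpecOf K)) (by rw [z.2, Category.id_comp])

/-- The point of the base change `X_K` underlying a `K`-point of `X`. -/
def Points.toBaseChange {x : X ⟶ SpecOf k} (z : Points K x) : baseChange K x :=
  Points.lift z (IsLocalRing.closedPoint K)

/-- The ramification index of `f : X ⟶ Y` at a point `x` of `X`: the largest `e` such that the
maximal ideal of `𝒪_{Y, f x}` generates an ideal contained in the `e`-th power of the maximal
ideal of `𝒪_{X, x}`. -/
def ramificationIndexAt (f : X ⟶ Y) (x : X) : ℕ :=
  letI := (f.stalkMap x).hom.toAlgebra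
  Ideal.ramificationIdx' (IsLocalRing.maximalIdeal (Y.presheaf.stalk (f x)))
    (IsLocalRing.maximalIdeal (X.presheaf.stalk x))

/-- The ramification index of a `k`-morphism at a `K`-point `z` of the source, computed after
base change to `K`. -/
def ramificationIndex {x : X ⟶ SpecOf k} {y : Y ⟶ SpecOf k} (f : X ⟶ Y) (hf : f ≫ y = x)
    (z : Points K x) : ℕ :=
  ramificationIndexAt (baseChangeMap K f hf) (Points.toBaseChange z)

end SelfCorr

namespace SelfCorrespondence

open SelfCorr

variable {k : Type u} [Field k] {K : Type u} [Field K] [Algebra k K]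
  {C : Scheme.{u}} {c : C ⟶ SpecOf k} (D : SelfCorrespondence c)

/-- The source map `π₁ : D(K) → C(K)`. -/
def src (z : Points K D.d) : Points K c := Points.map D.π₁ D.π₁_comp z

/-- The target map `π₂ : D(K) → C(K)`. -/
def tgt (z : Points K D.d) : Points K c := Points.map D.π₂ D.π₂_comp z

/-- The ramification index `e_{1,z}` of `π₁` at `z`. -/
def e₁ (z : Points K D.d) : ℕ := ramificationIndex D.π₁ D.π₁_comp z

/-- The ramification index `e_{2,z}` of `π₂` at `z`. -/
def e₂ (z : Points K D.d) : ℕ := ramificationIndex D.π₂ D.π₂_comp z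

/-- A subset `S` of `C(K)` is complete if `π₁⁻¹(S) = π₂⁻¹(S)` in `D(K)`. -/
def IsComplete (S : Set (Points K c)) : Prop :=
  (D.src ⁻¹' S : Set (Points K D.d)) = D.tgt ⁻¹' S

/-- An irreducible complete set is a minimal non-empty complete set. -/
def IsIrreducibleComplete (S : Set (Points K c)) : Prop :=
  Minimal (fun T : Set (Points K c) => T.Nonempty ∧ D.IsComplete T) S

/-- `S` is equiramified if `e_{1,z} = e_{2,z}` for all `z ∈ D(K)` with both ends in `S`. -/
def IsEquiramified (S : Set (Points K c)) : Prop :=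
  ∀ z : Points K D.d, D.src z ∈ S → D.tgt z ∈ S → D.e₁ z = D.e₂ z

variable (K) in
/-- The self-correspondence is finitary if all its irreducible complete sets (in `C(K)`, with `K`
an algebraic closure of `k`) are finite, of cardinality bounded by some integer `M`. -/
def IsFinitary : Prop :=
  ∃ M : ℕ, ∀ S : Set (Points K c), D.IsIrreducibleComplete S → S.encard ≤ M

end SelfCorrespondence

end

/-! Let `f` be the rational function on the line over `K` with divisor `|S'|·S - |S|·S'`. A complete
set has the same preimage under both projections, and equiramification gives each point of that
preimage the same multiplicity in both pullbacks. So `π₁^* f` and `π₂^* f` have the same divisor,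
and on each component, proper and integral after base change to `K`, they differ by a nonzero
constant `c i` (`exists_form_eq_of_component`).

There are finitely many components. If every `c i` is a root of unity, some power `f ^ N` is
invariant; each irreducible complete set other than `S`, `S'` then lies in a fibre of `f ^ N`, whose
cardinality is bounded, and the correspondence is finitary. Hence some `c i` has infinite order. A
finite irreducible complete set `T` other than `S`, `S'` is disjoint from both, so `f` takes finite
nonzero values on `T`. Since `π₂` is surjective on the `i`-th component, `f(T)` is stable under
multiplication by `c i`, hence infinite, which is absurd (`eq_or_eq_of_not_finitary`). The bound by
two is a formal consequence.

The comparison of divisors rests on two facts. At a rational point of a smooth curve the maximal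
ideal is principal, so a ramification index determines a local equation up to a unit
(`LineChart.associated_form`). On a proper integral scheme a rational function regular at all closed
points is constant (`exists_scalStalk_eq_of_regular`). The function `f` is handled as a quotient `F
/ G` of forms of equal degree in local homogeneous coordinates. These need only the data of
`LineChart`, which survives base change, so the base change of the line to `K` is never identified
with `projectiveLine K`. -/

noncomputable section

namespace SelfCorr

/-! ### Local algebra: principal maximal ideals and orders of vanishing -/

/-- In a noetherian local ring whose maximal ideal is generated by `t`, every nonzero element is
a unit times a power of `t`. -/
lemma exists_eq_pow_mul_unit {O : Type*} [CommRing O] [IsLocalRing O] [IsNoetherianRing O] {t : O}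
    (ht : IsLocalRing.maximalIdeal O = Ideal.span {t}) {x : O} (hx : x ≠ 0) :
    ∃ (n : ℕ) (w : Oˣ), x = t ^ n * w := by
  classical
  have hbot := Ideal.iInf_pow_eq_bot_of_isLocalRing (IsLocalRing.maximalIdeal O)
    (IsLocalRing.maximalIdeal.isMaximal O).ne_top
  have hex : ∃ n, x ∉ IsLocalRing.maximalIdeal O ^ n := by
    by_contra! h
    exact hx (by simpa [hbot] using (Ideal.mem_iInf.mpr h : x ∈ ⨅ n, _))
  obtain ⟨m, hm⟩ : ∃ m, Nat.find hex = m + 1 := by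
    refine Nat.exists_eq_succ_of_ne_zero fun h => ?_
    have := Nat.find_spec hex
    rw [h] at this
    simp at this
  have h1 : x ∈ IsLocalRing.maximalIdeal O ^ m := by
    have := Nat.find_min hex (m := m) (by omega)
    simpa using this
  have h2 : x ∉ IsLocalRing.maximalIdeal O ^ (m + 1) := hm ▸ Nat.find_spec hex
  rw [ht, Ideal.span_singleton_pow, Ideal.mem_span_singleton] at h1 h2
  obtain ⟨w, rfl⟩ := h1
  have hw : IsUnit w := by
    by_contra hw
    have : w ∈ IsLocalRing.maximalIdeal O := hw
    rw [ht, Ideal.mem_span_singleton] at this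
    obtain ⟨v, rfl⟩ := this
    exact h2 ⟨v, by ring⟩
  exact ⟨m, hw.unit, rfl⟩

/-- Nonzero elements are units times powers of `t`, and no power of the nonzerodivisor `t` vanishes.
-/
lemma isDomain_of_maximalIdeal_eq_span {O : Type*} [CommRing O] [IsLocalRing O]
    [IsNoetherianRing O] {t : O} (ht : IsLocalRing.maximalIdeal O = Ideal.span {t})
    (hreg : ∀ x, t * x = 0 → x = 0) : IsDomain O := by
  have hpow : ∀ n : ℕ, t ^ n ≠ 0 := by
    intro n
    induction n with
    | zero => simp
    | succ n ih => exact fun h => ih (hreg _ (by rw [← h]; ring))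
  have : NoZeroDivisors O := by
    refine ⟨fun {a b} hab => ?_⟩
    by_contra! h
    obtain ⟨n, v, rfl⟩ := exists_eq_pow_mul_unit ht h.1
    obtain ⟨m, w, rfl⟩ := exists_eq_pow_mul_unit ht h.2
    refine hpow (n + m) ?_
    have h3 : t ^ (n + m) * ((v * w : Oˣ) : O) = 0 := by
      rw [← hab]; push_cast; ring
    exact (Units.mul_left_eq_zero _).mp h3
  exact NoZeroDivisors.to_isDomain O

lemma mvPolynomial_sub_C_mem_span {R : Type*} [CommRing R] (a : R) (p : MvPolynomial (Fin 1) R) :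
    p - MvPolynomial.C (MvPolynomial.eval (fun _ => a) p) ∈
      Ideal.span {(MvPolynomial.X 0 - MvPolynomial.C a : MvPolynomial (Fin 1) R)} := by
  set I := Ideal.span {(MvPolynomial.X 0 - MvPolynomial.C a : MvPolynomial (Fin 1) R)}
  have h : Ideal.Quotient.mk I =
      ((Ideal.Quotient.mk I).comp MvPolynomial.C).comp (MvPolynomial.eval fun _ => a) := by
    refine MvPolynomial.ringHom_ext (by simp) fun i => ?_
    obtain rfl : i = 0 := Subsingleton.elim _ _
    simp only [RingHom.coe_comp, Function.comp_apply, MvPolynomial.eval_X]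
    exact Ideal.Quotient.eq.mpr (Ideal.mem_span_singleton_self _)
  exact Ideal.Quotient.eq.mp (RingHom.congr_fun h p)

/-- The local ring of a standard smooth algebra of relative dimension one at a rational point is
a domain with principal nonzero maximal ideal. -/
lemma exists_maximalIdeal_eq_span_of_standardSmooth {R A O : Type u} [CommRing R] [IsDomain R]
    [CommRing A]
    (f : R →+* A) (hf : f.IsStandardSmoothOfRelativeDimension 1) (q : Ideal A) [q.IsPrime]
    (hq : ∀ a, ∃ c, a - f c ∈ q) (h0 : ∀ c, f c ∈ q → c = 0)
    [CommRing O] [IsLocalRing O] [IsNoetherianRing O] [Algebra A O] [IsLocalization.AtPrime O q] :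
    IsDomain O ∧ ∃ t : O, t ≠ 0 ∧ IsLocalRing.maximalIdeal O = Ideal.span {t} := by
  obtain ⟨g, hgf, hg⟩ := hf.exists_etale_mvPolynomial
  algebraize [g]
  have hgA : algebraMap (MvPolynomial (Fin 1) R) A = g := rfl
  have hgC : ∀ c, g (MvPolynomial.C c) = f c := fun c => RingHom.congr_fun hgf c
  obtain ⟨a, ha⟩ := hq (g (MvPolynomial.X 0))
  let p : Ideal (MvPolynomial (Fin 1) R) := q.comap g
  -- Rationality of the point makes every polynomial congruent to a constant modulo `X - a`, and
  -- only the zero constant lies in `p`.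
  have hp : p = Ideal.span {MvPolynomial.X 0 - MvPolynomial.C a} := by
    have h1 : (MvPolynomial.X 0 - MvPolynomial.C a : MvPolynomial (Fin 1) R) ∈ p := by
      simpa [p, Ideal.mem_comap, hgC] using ha
    refine le_antisymm (fun x hx => ?_) ((Ideal.span_singleton_le_iff_mem _).mpr h1)
    have h2 := mvPolynomial_sub_C_mem_span a x
    have h3 := p.sub_mem hx ((Ideal.span_singleton_le_iff_mem _).mpr h1 h2)
    rw [sub_sub_cancel] at h3
    have h4 := h0 _ (by simpa [p, Ideal.mem_comap, hgC] using h3)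
    simpa [h4] using h2
  have : p.IsPrime := Ideal.IsPrime.comap g
  have : q.LiesOver p := ⟨rfl⟩
  let := Localization.AtPrime.algebraOfLiesOver p q
  -- Étale implies unramified: the maximal ideal at `p`, generated by `X - a`, generates the maximal
  -- ideal at `q`.
  have key := ((Algebra.isUnramifiedAt_iff_map_eq (MvPolynomial (Fin 1) R) p q).mp
    inferInstance).2
  let e : Localization.AtPrime q ≃ₐ[A] O := IsLocalization.algEquiv q.primeCompl _ _
  have hmax : IsLocalRing.maximalIdeal O =
      Ideal.span {algebraMap A O (g (MvPolynomial.X 0 - MvPolynomial.C a))} := by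
    rw [← IsLocalRing.map_ringEquiv_maximalIdeal e.toRingEquiv, ← key, hp,
      Ideal.map_span, Ideal.map_span, Set.image_singleton, Set.image_singleton]
    congr 2
    change e (algebraMap _ _ _) = _
    rw [IsScalarTower.algebraMap_apply _ A (Localization.AtPrime q), e.commutes]
    rfl
  let : Algebra (MvPolynomial (Fin 1) R) O := ((algebraMap A O).comp g).toAlgebra
  have : IsScalarTower (MvPolynomial (Fin 1) R) A O := .of_algebraMap_eq' rfl
  have : Module.Flat A O := IsLocalization.flat O q.primeCompl
  have : Module.Flat (MvPolynomial (Fin 1) R) A := inferInstance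
  have : Module.Flat (MvPolynomial (Fin 1) R) O := Module.Flat.trans _ A _
  have hne : (MvPolynomial.X 0 - MvPolynomial.C a : MvPolynomial (Fin 1) R) ≠ 0 := by
    intro h
    have h5 := congrArg (MvPolynomial.eval fun _ => a + 1) h
    simp at h5
  -- Flatness over the polynomial ring keeps `X - a` a nonzerodivisor.
  have hreg : ∀ x : O, algebraMap A O (g (MvPolynomial.X 0 - MvPolynomial.C a)) * x = 0 →
      x = 0 := by
    intro x hx
    have h6 : IsSMulRegular O (MvPolynomial.X 0 - MvPolynomial.C a : MvPolynomial (Fin 1) R) :=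
      Module.Flat.isSMulRegular_of_nonZeroDivisors (mem_nonZeroDivisors_of_ne_zero hne)
    exact h6.right_eq_zero_of_smul (by rw [Algebra.smul_def]; exact hx)
  refine ⟨isDomain_of_maximalIdeal_eq_span hmax hreg, _, fun h => ?_, hmax⟩
  exact one_ne_zero (hreg 1 (by rw [h, zero_mul]))

/-- In a local domain with principal nonzero maximal ideal, two nonzero elements with the same
order of vanishing, measured through ideals generated by them, are associated. -/
lemma associated_of_ramificationIdx'_eq {O A B : Type*} [CommRing O] [IsLocalRing O]
    [IsNoetherianRing O] [IsDomain O] {t : O} (ht0 : t ≠ 0)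
    (ht : IsLocalRing.maximalIdeal O = Ideal.span {t}) [CommRing A] [CommRing B] [Algebra A O]
    [Algebra B O] (I : Ideal A) (J : Ideal B) {x y : O} (hx0 : x ≠ 0) (hy0 : y ≠ 0)
    (hx : I.map (algebraMap A O) = Ideal.span {x}) (hy : J.map (algebraMap B O) = Ideal.span {y})
    (h : I.ramificationIdx' (IsLocalRing.maximalIdeal O) =
      J.ramificationIdx' (IsLocalRing.maximalIdeal O)) : Associated x y := by
  obtain ⟨n, v, rfl⟩ := exists_eq_pow_mul_unit ht hx0
  obtain ⟨m, w, rfl⟩ := exists_eq_pow_mul_unit ht hy0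
  have aux : ∀ n : ℕ, ¬ Ideal.span {t ^ n} ≤ Ideal.span {t ^ (n + 1)} := by
    intro n hn
    rw [Ideal.span_singleton_le_span_singleton, pow_succ] at hn
    have h1 : IsUnit t := isUnit_of_dvd_one ((mul_dvd_mul_iff_left (pow_ne_zero n ht0)).mp
      (by simpa using hn))
    have h2 : t ∈ IsLocalRing.maximalIdeal O := ht ▸ Ideal.mem_span_singleton_self t
    exact h2 h1
  have e1 : I.ramificationIdx' (IsLocalRing.maximalIdeal O) = n := by
    refine Ideal.ramificationIdx'_spec ?_ ?_ <;>
      rw [hx, ht, Ideal.span_singleton_pow, Ideal.span_singleton_mul_right_unit v.isUnit]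
    exact aux n
  have e2 : J.ramificationIdx' (IsLocalRing.maximalIdeal O) = m := by
    refine Ideal.ramificationIdx'_spec ?_ ?_ <;>
      rw [hy, ht, Ideal.span_singleton_pow, Ideal.span_singleton_mul_right_unit w.isUnit]
    exact aux m
  obtain rfl : n = m := by rw [← e1, ← e2, h]
  exact ((associated_mul_unit_left _ _ v.isUnit)).trans
    (associated_mul_unit_right _ _ w.isUnit)

/-! ### Constants in local rings, and evaluation at rational points -/

section Scalars

variable {K : Type u} [Field K] {X Y : Scheme.{u}}

/-- The constants on an open subset of a `K`-scheme. -/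
def scal (f : X ⟶ SpecOf K) (U : X.Opens) : K →+* Γ(X, U) :=
  ((Scheme.ΓSpecIso (CommRingCat.of K)).inv ≫ f.appTop ≫ X.presheaf.map (homOfLE le_top).op).hom

/-- The constants in a local ring of a `K`-scheme. -/
def scalStalk (f : X ⟶ SpecOf K) (x : X) : K →+* X.presheaf.stalk x :=
  ((Scheme.ΓSpecIso (CommRingCat.of K)).inv ≫ f.appTop ≫
    X.presheaf.germ ⊤ x (TopologicalSpace.Opens.mem_top x)).hom

lemma germ_scal (f : X ⟶ SpecOf K) (U : X.Opens) (x : X) (hx : x ∈ U) (a : K) :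
    X.presheaf.germ U x hx (scal f U a) = scalStalk f x a :=
  X.presheaf.germ_res_apply _ _ _ _

lemma stalkSpecializes_scalStalk (f : X ⟶ SpecOf K) {x y : X} (h : x ⤳ y) (a : K) :
    X.presheaf.stalkSpecializes h (scalStalk f y a) = scalStalk f x a :=
  X.presheaf.germ_stalkSpecializes_apply _ _ _

lemma stalkMap_scalStalk {f : X ⟶ SpecOf K} {g : Y ⟶ SpecOf K} (φ : X ⟶ Y) (h : φ ≫ g = f)
    (x : X) (a : K) : φ.stalkMap x (scalStalk g (φ x) a) = scalStalk f x a := by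
  subst h
  refine (Scheme.Hom.germ_stalkMap_apply φ ⊤ x (TopologicalSpace.Opens.mem_top _) _).trans ?_
  rfl

/-- Evaluation at a rational point is thus a retraction of the constants, the only form in which
rationality is used below. -/
lemma stalkClosedPointTo_scalStalk {f : X ⟶ SpecOf K} (s : SpecOf K ⟶ X) (hs : s ≫ f = 𝟙 _)
    (a : K) : Scheme.stalkClosedPointTo s (scalStalk f _ a) = a := by
  have h := stalkMap_scalStalk s hs (IsLocalRing.closedPoint K) a
  refine (congrArg (stalkClosedPointIso (CommRingCat.of K)).hom h).trans ?_
  have h2 := germ_stalkClosedPointIso_hom (CommRingCat.of K)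
  have h3 := congr(($h2) ((Scheme.ΓSpecIso (CommRingCat.of K)).inv a))
  refine Eq.trans ?_ (h3.trans (by simp))
  simp [scalStalk]

/-- A retraction of the constants in a local ring vanishes exactly on the maximal ideal. -/
lemma retraction_eq_zero_iff {O : Type*} [CommRing O] [IsLocalRing O] {κ : K →+* O} {ev : O →+* K}
    (h : ∀ a, ev (κ a) = a) (y : O) : ev y = 0 ↔ y ∈ IsLocalRing.maximalIdeal O := by
  constructor
  · intro hy hu
    exact (hu.map ev).ne_zero hy
  · intro hy
    by_contra hne
    have h1 : y - κ (ev y) ∈ IsLocalRing.maximalIdeal O := by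
      intro hu
      exact (hu.map ev).ne_zero (by simp [h])
    have h2 := Ideal.sub_mem _ hy h1
    rw [sub_sub_cancel] at h2
    exact h2 ((isUnit_iff_ne_zero.mpr hne).map κ)

/-- The retraction `ev` makes the residue field at `x` equal to `K`, so the algebraic statement
applies in a standard smooth chart around `x`. -/
lemma exists_maximalIdeal_stalk_eq_span (f : X ⟶ SpecOf K) [SmoothOfRelativeDimension 1 f] (x : X)
    (ev : X.presheaf.stalk x →+* K) (hev : ∀ a, ev (scalStalk f x a) = a) :
    IsDomain (X.presheaf.stalk x) ∧ ∃ t : X.presheaf.stalk x, t ≠ 0 ∧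
      IsLocalRing.maximalIdeal (X.presheaf.stalk x) = Ideal.span {t} := by
  have : Smooth f := SmoothOfRelativeDimension.smooth 1 f
  have : IsLocallyNoetherian X := LocallyOfFiniteType.isLocallyNoetherian f
  obtain ⟨U, hU, V, hV, hxV, e, hf⟩ :=
    SmoothOfRelativeDimension.exists_isStandardSmoothOfRelativeDimension (n := 1) (f := f) x
  obtain rfl : U = ⊤ := by
    ext y
    simpa using (Subsingleton.elim y (f x)) ▸ e hxV
  have hR : IsDomain Γ(SpecOf K, ⊤) :=
    (Scheme.ΓSpecIso (CommRingCat.of K)).commRingCatIsoToRingEquiv.toMulEquiv.isDomain K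
  let := TopCat.Presheaf.algebra_section_stalk X.presheaf ⟨x, hxV⟩
  have hloc := hV.isLocalization_stalk ⟨x, hxV⟩
  have hval : ∀ c, (f.appLE ⊤ V e).hom c =
      scal f V ((Scheme.ΓSpecIso (CommRingCat.of K)).hom c) := by
    intro c
    simp [scal, Scheme.Hom.appLE]
    rfl
  have hq : ∀ y : Γ(X, V), y ∈ (hV.primeIdealOf ⟨x, hxV⟩).asIdeal ↔
      ev (X.presheaf.germ V x hxV y) = 0 := by
    intro y
    rw [retraction_eq_zero_iff hev, hV.primeIdealOf_eq_map_closedPoint]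
    rfl
  refine exists_maximalIdeal_eq_span_of_standardSmooth (f.appLE ⊤ V e).hom hf
    (hV.primeIdealOf ⟨x, hxV⟩).asIdeal (fun a => ?_) (fun c hc => ?_)
  · refine ⟨(Scheme.ΓSpecIso (CommRingCat.of K)).inv (ev (X.presheaf.germ V x hxV a)), ?_⟩
    rw [hq, hval, map_sub, map_sub, germ_scal, hev]
    simp
  · rw [hq, hval, germ_scal, hev] at hc
    exact (Scheme.ΓSpecIso (CommRingCat.of K)).commRingCatIsoToRingEquiv.injective
      (hc.trans (map_zero _).symm)

end Scalars

/-! ### Closed points, reducedness and regular functions over an algebraically closed field -/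

section AlgClosed

variable {K : Type u} [Field K] [IsAlgClosed K] {X : Scheme.{u}}

/-- A closed point of a scheme locally of finite type over an algebraically closed field is
rational. -/
lemma exists_retraction_of_isClosed (f : X ⟶ SpecOf K) [LocallyOfFiniteType f] {x : X}
    (hx : IsClosed {x}) :
    ∃ s : SpecOf K ⟶ X, s ≫ f = 𝟙 _ ∧ s (IsLocalRing.closedPoint K) = x :=
  ⟨pointOfClosedPoint f x hx, pointOfClosedPoint_comp f x hx, pointOfClosedPoint_apply f x hx _⟩

lemma exists_maximalIdeal_stalk_eq_span_of_isClosed (f : X ⟶ SpecOf K)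
    [SmoothOfRelativeDimension 1 f] {x : X} (hx : IsClosed {x}) :
    IsDomain (X.presheaf.stalk x) ∧ ∃ t : X.presheaf.stalk x, t ≠ 0 ∧
      IsLocalRing.maximalIdeal (X.presheaf.stalk x) = Ideal.span {t} := by
  have : Smooth f := SmoothOfRelativeDimension.smooth 1 f
  obtain ⟨s, hs, rfl⟩ := exists_retraction_of_isClosed f hx
  exact exists_maximalIdeal_stalk_eq_span f _ (Scheme.stalkClosedPointTo s).hom
    (stalkClosedPointTo_scalStalk s hs)

/-- The stalks at closed points are domains, and a nilpotent section vanishing at all of these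
vanishes, since closed points are dense in every locally closed subset. -/
lemma isReduced_of_smoothOfRelativeDimension_one (f : X ⟶ SpecOf K)
    [SmoothOfRelativeDimension 1 f] : IsReduced X := by
  have : Smooth f := SmoothOfRelativeDimension.smooth 1 f
  have : JacobsonSpace X := LocallyOfFiniteType.jacobsonSpace f
  refine ⟨fun U => ⟨fun s hs => ?_⟩⟩
  refine TopCat.Presheaf.section_ext X.sheaf U s 0 fun x hx => ?_
  rw [map_zero]
  by_contra hne
  -- `Z` is the open locus of `U` where `s` vanishes locally. A nonempty `U \ Z` would be locally
  -- closed and so contain a closed point.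
  let Z : X.Opens := ⟨{y | ∃ (W : X.Opens) (h : W ≤ U), y ∈ W ∧
    X.presheaf.map (homOfLE h).op s = 0}, by
      rw [isOpen_iff_forall_mem_open]
      rintro y ⟨W, h, hy, h0⟩
      exact ⟨W, fun z hz => ⟨W, h, hz, h0⟩, W.2, hy⟩⟩
  have hZ : ∀ y (hy : y ∈ U), X.presheaf.germ U y hy s = 0 → y ∈ Z := by
    intro y hy h
    obtain ⟨W, hW, i, j, hij⟩ := X.presheaf.germ_eq y hy hy s 0 (by rw [h, map_zero])
    exact ⟨W, i.le, hW, by rw [map_zero] at hij; exact hij⟩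
  have hxZ : x ∉ Z := by
    rintro ⟨W, h, hy, h0⟩
    refine hne ?_
    change X.presheaf.germ U x hx s = 0
    rw [← X.presheaf.germ_res_apply (homOfLE h) x hy s, h0, map_zero]
  obtain ⟨y, ⟨hyU, hyZ⟩, hy⟩ := nonempty_inter_closedPoints
    (Z := (U : Set X) ∩ (Z : Set X)ᶜ) ⟨x, hx, hxZ⟩
    (U.2.isLocallyClosed.inter Z.2.isClosed_compl.isLocallyClosed)
  have hd := (exists_maximalIdeal_stalk_eq_span_of_isClosed f hy).1
  exact hyZ (hZ y hyU (hs.map (X.presheaf.germ U y hyU).hom).eq_zero)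

/-- A rational function on a quasi-compact integral scheme which is regular at all closed points
is a global section. -/
lemma exists_germToFunctionField_eq [IsIntegral X] [CompactSpace X] [Nonempty (⊤ : X.Opens)]
    (g : X.functionField)
    (h : ∀ x : X, IsClosed {x} → ∃ w : X.presheaf.stalk x,
      algebraMap (X.presheaf.stalk x) X.functionField w = g) :
    ∃ a : Γ(X, ⊤), X.germToFunctionField ⊤ a = g := by
  have h' : ∀ x : closedPoints X, ∃ (U : X.Opens) (_ : x.1 ∈ U) (s : Γ(X, U)),
      ∀ [Nonempty U], X.germToFunctionField U s = g := by
    rintro ⟨x, hx⟩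
    obtain ⟨w, rfl⟩ := h x hx
    obtain ⟨U, hU, s, rfl⟩ := X.presheaf.exists_germ_eq w
    refine ⟨U, hU, s, ?_⟩
    intro _
    exact (Scheme.algebraMap_germ_eq_germToFunctionField X hU s).symm
  choose U hU s hs using h'
  have hne : ∀ x, Nonempty (U x) := fun x => ⟨⟨x.1, hU x⟩⟩
  -- The complement of the union is closed in a quasi-compact space; if nonempty it contains a
  -- closed point, and these are all covered.
  have hcov : (⊤ : X.Opens) ≤ iSup U := by
    by_contra hcon
    have hcl : IsClosed ((iSup U : X.Opens) : Set X)ᶜ := (iSup U).2.isClosed_compl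
    obtain ⟨x, hx, hxc⟩ := hcl.exists_closed_singleton (by
      rw [Set.nonempty_compl]
      intro h2
      exact hcon (fun y _ => by
        change y ∈ ((iSup U : X.Opens) : Set X)
        rw [h2]; trivial))
    exact hx (TopologicalSpace.Opens.mem_iSup.mpr ⟨⟨x, hxc⟩, hU ⟨x, hxc⟩⟩)
  obtain ⟨a, ha, -⟩ := X.sheaf.existsUnique_gluing' U ⊤ (fun i => homOfLE le_top) hcov s (by
    intro x y
    have : Nonempty (U x ⊓ U y : X.Opens) := by
      have hx := (genericPoint_spec X).mem_open_set_iff (U x).isOpen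
      have hy := (genericPoint_spec X).mem_open_set_iff (U y).isOpen
      exact ⟨⟨genericPoint X, hx.mpr (by simpa using hne x), hy.mpr (by simpa using hne y)⟩⟩
    apply X.germToFunctionField_injective (U x ⊓ U y)
    have h1 := hs x
    have h2 := hs y
    refine Eq.trans ?_ ((h1.trans h2.symm).trans ?_)
    · exact X.presheaf.germ_res_apply _ _ _ _
    · exact (X.presheaf.germ_res_apply _ _ _ _).symm)
  have hpt : (genericPoint X) ∈ iSup U := hcov trivial
  obtain ⟨x, hx⟩ := TopologicalSpace.Opens.mem_iSup.mp hpt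
  refine ⟨a, ?_⟩
  rw [← hs x, ← ha x]
  exact (X.presheaf.germ_res_apply _ _ _ _).symm

/-- On a proper integral scheme over an algebraically closed field, a rational function which is
regular at all closed points is constant. -/
lemma exists_scalStalk_eq_of_regular [IsIntegral X] (f : X ⟶ SpecOf K) [UniversallyClosed f]
    (g : X.functionField)
    (h : ∀ x : X, IsClosed {x} → ∃ w : X.presheaf.stalk x,
      algebraMap (X.presheaf.stalk x) X.functionField w = g) :
    ∃ c : K, scalStalk f (genericPoint X) c = g := by
  have : CompactSpace X := (quasiCompact_iff_compactSpace f).mp inferInstance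
  have : Nonempty (⊤ : X.Opens) := ⟨⟨genericPoint X, TopologicalSpace.Opens.mem_top _⟩⟩
  obtain ⟨a, rfl⟩ := exists_germToFunctionField_eq g h
  -- Global functions on a universally closed scheme are integral over `K`, hence constants as `K`
  -- is algebraically closed.
  have hint : (scal f ⊤).IsIntegral := by
    have h1 := isIntegral_appTop_of_universallyClosed f
    have h2 : (scal f ⊤) = (f.appTop.hom).comp
        (Scheme.ΓSpecIso (CommRingCat.of K)).inv.hom := by
      ext a
      simp [scal]
    rw [h2]
    exact RingHom.IsIntegral.trans _ _ (RingHom.isIntegral_of_surjective _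
      (Scheme.ΓSpecIso (CommRingCat.of K)).symm.commRingCatIsoToRingEquiv.surjective) h1
  obtain ⟨c, rfl⟩ := (IsAlgClosed.ringHom_bijective_of_isIntegral _ hint).2 a
  exact ⟨c, (germ_scal f ⊤ (genericPoint X) _ c).symm⟩

end AlgClosed

/-! ### Charts of a projective line and their base change -/

/-- The standard affine charts of a projective line: two affine lines with coordinates `t` and
`u`, glued along `t * u = 1`. -/
structure LineChart {k : Type u} [Field k] {P : Scheme.{u}} (q : P ⟶ SpecOf k) where
  U₀ : P.Opens
  U₁ : P.Opens
  t : Γ(P, U₀)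
  u : Γ(P, U₁)
  affine₀ : IsAffineOpen U₀
  affine₁ : IsAffineOpen U₁
  cover : ∀ p : P, p ∈ U₀ ∨ p ∈ U₁
  mul_eq : ∀ (p : P) (h₀ : p ∈ U₀) (h₁ : p ∈ U₁),
    P.presheaf.germ U₀ p h₀ t * P.presheaf.germ U₁ p h₁ u = 1
  mem₀ : ∀ (p : P) (h₁ : p ∈ U₁), IsUnit (P.presheaf.germ U₁ p h₁ u) → p ∈ U₀
  gen₀ : ∀ s : Subring Γ(P, U₀), (∀ a, scal q U₀ a ∈ s) → t ∈ s → s = ⊤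
  gen₁ : ∀ s : Subring Γ(P, U₁), (∀ a, scal q U₁ a ∈ s) → u ∈ s → s = ⊤

section BaseChange

variable {k : Type u} [Field k] (K : Type u) [Field K] [Algebra k K] {P : Scheme.{u}}
  (q : P ⟶ SpecOf k)

/-- The universal property maps `R` back into `s`, splitting the inclusion. -/
lemma subring_eq_top_of_isPushout {A B C R : CommRingCat.{u}} {f : A ⟶ B} {g : A ⟶ C} {i : B ⟶ R}
    {j : C ⟶ R} (h : IsPushout f g i j) (s : Subring R) (hi : ∀ b, i b ∈ s) (hj : ∀ c, j c ∈ s) :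
    s = ⊤ := by
  let i' : B ⟶ CommRingCat.of s := CommRingCat.ofHom (i.hom.codRestrict s hi)
  let j' : C ⟶ CommRingCat.of s := CommRingCat.ofHom (j.hom.codRestrict s hj)
  have hw : f ≫ i' = g ≫ j' := by
    refine CommRingCat.hom_ext (RingHom.ext fun a => Subtype.ext ?_)
    exact congr(($h.w) a)
  let d : R ⟶ CommRingCat.of s := h.desc i' j' hw
  have hd : d ≫ CommRingCat.ofHom s.subtype = 𝟙 R := by
    refine h.hom_ext ?_ ?_
    · rw [h.inl_desc_assoc, Category.comp_id]; rfl
    · rw [h.inr_desc_assoc, Category.comp_id]; rfl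
  rw [eq_top_iff]
  intro r _
  have h1 : ((d r : s) : R) = r := congr(($hd) r)
  rw [← h1]
  exact (d r : s).2

lemma app_fst_scal (U : P.Opens) (a : k) :
    (pullback.fst q (specMap k K)).app U (scal q U a) =
      scal (pullback.snd q (specMap k K)) (pullback.fst q (specMap k K) ⁻¹ᵁ U)
        (algebraMap k K a) := by
  have h1 : (Scheme.ΓSpecIso (CommRingCat.of K)).inv (algebraMap k K a) =
      (specMap k K).appTop ((Scheme.ΓSpecIso (CommRingCat.of k)).inv a) :=
    congr(($(Scheme.ΓSpecIso_inv_naturality (CommRingCat.ofHom (algebraMap k K)))) a)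
  have h2 : (pullback.fst q (specMap k K)).app U (P.presheaf.map (homOfLE le_top).op
      (q.appTop ((Scheme.ΓSpecIso (CommRingCat.of k)).inv a))) =
      (baseChange K q).presheaf.map (homOfLE le_top).op
        ((pullback.fst q (specMap k K)).appTop (q.appTop
        ((Scheme.ΓSpecIso (CommRingCat.of k)).inv a))) :=
    congr(($((pullback.fst q (specMap k K)).naturality
      (homOfLE (le_top : U ≤ ⊤)).op)) _)
  refine h2.trans ?_
  change _ = (baseChange K q).presheaf.map (homOfLE le_top).op
    ((pullback.snd q (specMap k K)).appTop
      ((Scheme.ΓSpecIso (CommRingCat.of K)).inv (algebraMap k K a)))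
  rw [h1]
  congr 1
  have h3 := congr(Scheme.Hom.appTop $(pullback.condition (f := q) (g := specMap k K)))
  rw [Scheme.Hom.comp_appTop, Scheme.Hom.comp_appTop] at h3
  exact congr(($h3) _)

/-- Sections over the preimage of an affine open form the pushout of `Γ(P, U)` and `K` over `k`, so
these two generate them. This transports the fields `gen₀` and `gen₁`. -/
lemma subring_baseChange_eq_top {U : P.Opens} (hU : IsAffineOpen U)
    (s : Subring Γ(baseChange K q, pullback.fst q (specMap k K) ⁻¹ᵁ U))
    (h₁ : ∀ b : Γ(P, U), (pullback.fst q (specMap k K)).app U b ∈ s)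
    (h₂ : ∀ a : K, scal (pullback.snd q (specMap k K)) _ a ∈ s) : s = ⊤ := by
  have H := IsPullback.of_hasPullback q (specMap k K)
  have hiso := isIso_pushoutSection_of_isAffineOpen H (US := ⊤) (UT := ⊤) (UX := U)
    (UY := pullback.fst q (specMap k K) ⁻¹ᵁ U) le_top le_top (by simp)
    (isAffineOpen_top _) (isAffineOpen_top _) hU
  refine subring_eq_top_of_isPushout ((isIso_pushoutSection_iff H _ _ _).mp hiso) s ?_ ?_
  · intro b
    simpa [Scheme.Hom.appLE] using h₁ b
  · intro c
    have := h₂ ((Scheme.ΓSpecIso (CommRingCat.of K)).hom c)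
    have e : (Scheme.ΓSpecIso (CommRingCat.of K)).inv
        ((Scheme.ΓSpecIso (CommRingCat.of K)).hom c) = c := by simp
    change (pullback q (specMap k K)).presheaf.map (homOfLE le_top).op
      ((pullback.snd q (specMap k K)).appTop ((Scheme.ΓSpecIso (CommRingCat.of K)).inv
        ((Scheme.ΓSpecIso (CommRingCat.of K)).hom c))) ∈ s at this
    rwa [e] at this

lemma isAffineHom_fst : IsAffineHom (pullback.fst q (specMap k K)) :=
  MorphismProperty.IsStableUnderBaseChange.of_isPullback
    (IsPullback.of_hasPullback q (specMap k K)).flip inferInstance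

/-- Charts of the projective line over `k` induce charts after base change. -/
def LineChart.baseChange (C : LineChart q) : LineChart (pullback.snd q (specMap k K)) where
  U₀ := pullback.fst q (specMap k K) ⁻¹ᵁ C.U₀
  U₁ := pullback.fst q (specMap k K) ⁻¹ᵁ C.U₁
  t := (pullback.fst q (specMap k K)).app _ C.t
  u := (pullback.fst q (specMap k K)).app _ C.u
  affine₀ := have := isAffineHom_fst K q; C.affine₀.preimage _
  affine₁ := have := isAffineHom_fst K q; C.affine₁.preimage _
  cover p := C.cover _
  mul_eq p h₀ h₁ := by
    have h := congrArg ((pullback.fst q (specMap k K)).stalkMap p) (C.mul_eq _ h₀ h₁)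
    rw [map_mul, map_one] at h
    rw [← h]
    congr 1 <;> exact (Scheme.Hom.germ_stalkMap_apply _ _ _ _ _).symm
  mem₀ p h₁ hu := by
    refine C.mem₀ _ h₁ ?_
    have h := Scheme.Hom.germ_stalkMap_apply (pullback.fst q (specMap k K)) C.U₁ p h₁ C.u
    have h2 : IsUnit ((pullback.fst q (specMap k K)).stalkMap p (P.presheaf.germ C.U₁ _ h₁ C.u)) :=
      h ▸ hu
    exact isUnit_of_map_unit ((pullback.fst q (specMap k K)).stalkMap p).hom _ h2
  gen₀ s hs ht := by
    refine subring_baseChange_eq_top K q C.affine₀ s (fun b => ?_) hs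
    have := C.gen₀ (s.comap ((pullback.fst q (specMap k K)).app C.U₀).hom)
      (fun a => by
        change (pullback.fst q (specMap k K)).app C.U₀ (scal q C.U₀ a) ∈ s
        rw [app_fst_scal]; exact hs _) ht
    exact (this ▸ Subring.mem_top b : b ∈ s.comap ((pullback.fst q (specMap k K)).app C.U₀).hom)
  gen₁ s hs ht := by
    refine subring_baseChange_eq_top K q C.affine₁ s (fun b => ?_) hs
    have := C.gen₁ (s.comap ((pullback.fst q (specMap k K)).app C.U₁).hom)
      (fun a => by
        change (pullback.fst q (specMap k K)).app C.U₁ (scal q C.U₁ a) ∈ s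
        rw [app_fst_scal]; exact hs _) ht
    exact (this ▸ Subring.mem_top b : b ∈ s.comap ((pullback.fst q (specMap k K)).app C.U₁).hom)

end BaseChange

/-! ### The standard charts of `Proj k[X₀, X₁]` -/

section ProjChart

variable (k : Type u) [Field k]

attribute [local instance] MvPolynomial.gradedAlgebra

lemma scal_eq_of_ι_comp {P : Scheme.{u}} {q : P ⟶ SpecOf k} {U : P.Opens}
    (ψ : CommRingCat.of k ⟶ Γ(P, U)) (h : U.ι ≫ q = U.toSpecΓ ≫ Spec.map ψ) (a : k) :
    scal q U a = ψ a := by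
  have h1 := congr(Scheme.Hom.appTop $h)
  rw [Scheme.Hom.comp_appTop, Scheme.Hom.comp_appTop, Scheme.Opens.toSpecΓ_appTop,
    Scheme.ΓSpecIso_naturality_assoc, ← Iso.inv_comp_eq] at h1
  have h2 : (Scheme.ΓSpecIso (CommRingCat.of k)).inv ≫ q.appTop ≫ U.ι.appTop ≫ U.topIso.hom =
      ψ := by
    rw [← Category.assoc, ← Category.assoc, Category.assoc _ q.appTop, h1]
    simp only [Category.assoc, Iso.inv_hom_id, Category.comp_id]
  rw [← h2]
  change (P.presheaf.map (homOfLE le_top).op) (q.appTop _) =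
    U.topIso.hom (U.ι.appTop (q.appTop ((Scheme.ΓSpecIso (CommRingCat.of k)).inv a)))
  have h3 : U.ι.appTop ≫ U.topIso.hom = P.presheaf.map (homOfLE le_top).op := by
    rw [Scheme.Hom.appTop, Scheme.Opens.ι_app]
    change _ ≫ P.presheaf.map _ = _
    exact (P.presheaf.map_comp _ _).symm
  exact (congr(($h3) _)).symm

variable {k}

/-- The grading of the homogeneous coordinate ring of the projective line. -/
abbrev grading (k : Type u) [Field k] : ℕ → Submodule k (MvPolynomial (Fin 2) k) :=
  MvPolynomial.homogeneousSubmodule (Fin 2) k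

lemma X_mem_grading (i : Fin 2) : (MvPolynomial.X i : MvPolynomial (Fin 2) k) ∈ grading k 1 :=
  MvPolynomial.isHomogeneous_X k i

/-- The affine coordinate `X j / X i` on the standard open subset `X i ≠ 0`. -/
def projCoord (k : Type u) [Field k] (i j : Fin 2) :
    HomogeneousLocalization.Away (grading k) (MvPolynomial.X i : MvPolynomial (Fin 2) k) :=
  HomogeneousLocalization.Away.mk (grading k) (X_mem_grading i) 1 (MvPolynomial.X j)
    (X_mem_grading j)

lemma projCoord_val (i j : Fin 2) : (projCoord k i j).val =
    Localization.mk (MvPolynomial.X j) ⟨MvPolynomial.X i, Submonoid.mem_powers _⟩ := by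
  rw [projCoord, HomogeneousLocalization.Away.val_mk]
  simp

lemma proj_scal (i : Fin 2) (a : k) :
    scal (projectiveLineToSpec k) (Proj.basicOpen (grading k) (MvPolynomial.X i)) a =
      Proj.awayToSection (grading k) (MvPolynomial.X i)
        (HomogeneousLocalization.fromZeroRingHom (grading k) _
          (algebraMap k (grading k 0) a)) := by
  refine scal_eq_of_ι_comp k (CommRingCat.ofHom (algebraMap k (grading k 0)) ≫
    CommRingCat.ofHom (HomogeneousLocalization.fromZeroRingHom (grading k) _) ≫
    Proj.awayToSection (grading k) (MvPolynomial.X i)) ?_ a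
  rw [projectiveLineToSpec, Spec.map_comp, Spec.map_comp, ← Category.assoc, ← Category.assoc,
    ← Category.assoc]
  congr 1
  have h := Proj.awayι_toSpecZero (grading k) (MvPolynomial.X i : MvPolynomial (Fin 2) k)
    (X_mem_grading i) one_pos
  rw [Proj.awayι, Category.assoc, Iso.inv_comp_eq] at h
  exact h

lemma algebraMap_grading_zero_surjective : Function.Surjective (algebraMap k (grading k 0)) := by
  rintro ⟨p, hp⟩
  have h := MvPolynomial.totalDegree_eq_zero_iff_eq_C.mp
    (Nat.le_zero.mp (MvPolynomial.IsHomogeneous.totalDegree_le hp))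
  exact ⟨_, Subtype.ext h.symm⟩

/-- The degree-zero localization is spanned over the constants by fractions `X i ^ b * X j ^ c / X i
^ (b + c)`, which are powers of `X j / X i`. -/
lemma proj_gen (i j : Fin 2) (hij : i ≠ j)
    (s : Subring Γ(projectiveLine k, Proj.basicOpen (grading k) (MvPolynomial.X i)))
    (hs : ∀ a, scal (projectiveLineToSpec k) _ a ∈ s)
    (ht : Proj.awayToSection (grading k) (MvPolynomial.X i) (projCoord k i j) ∈ s) : s = ⊤ := by
  let φ := (Proj.awayToSection (grading k) (MvPolynomial.X i : MvPolynomial (Fin 2) k)).hom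
  have hadj := HomogeneousLocalization.Away.adjoin_mk_prod_pow_eq_top
    (𝒜 := grading k) (X_mem_grading i) (Fin 2) (fun j => (MvPolynomial.X j))
    (by
      rw [← top_le_iff]
      intro p _
      induction p using MvPolynomial.induction_on with
      | C a => exact Subalgebra.algebraMap_mem _ (algebraMap k (grading k 0) a)
      | add p q hp hq => exact add_mem (hp trivial) (hq trivial)
      | mul_X p j hp => exact mul_mem (hp trivial) (Algebra.subset_adjoin ⟨j, rfl⟩))
    (fun _ => 1) X_mem_grading
  let B : Subalgebra (grading k 0) (HomogeneousLocalization.Away (grading k)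
      (MvPolynomial.X i : MvPolynomial (Fin 2) k)) :=
    { s.comap φ with
      algebraMap_mem' := by
        intro a
        obtain ⟨a, rfl⟩ := algebraMap_grading_zero_surjective a
        have := hs a
        rw [proj_scal] at this
        exact this }
  have hB : B = ⊤ := by
    rw [← top_le_iff, ← hadj, Algebra.adjoin_le_iff]
    rintro _ ⟨a, ai, hai, h1, rfl⟩
    have hmem : projCoord k i j ^ ai j ∈ B := pow_mem (show projCoord k i j ∈ B from ht) _
    refine (congrArg (· ∈ B) ?_).mpr hmem
    apply HomogeneousLocalization.val_injective
    rw [HomogeneousLocalization.Away.val_mk, HomogeneousLocalization.val_pow, projCoord_val,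
      Localization.mk_pow, Localization.mk_eq_mk_iff, Localization.r_iff_exists]
    refine ⟨1, ?_⟩
    have h2 : ai i + ai j = a := by
      have : ∑ i, ai i = a := by simpa using hai
      rw [← this]
      fin_cases i <;> fin_cases j <;> simp_all [Fin.sum_univ_two, add_comm]
    have h3 : ∏ l, (MvPolynomial.X l : MvPolynomial (Fin 2) k) ^ ai l =
        MvPolynomial.X i ^ ai i * MvPolynomial.X j ^ ai j := by
      fin_cases i <;> fin_cases j <;> simp_all [Fin.prod_univ_two, mul_comm]
    simp only [h3, OneMemClass.coe_one, one_mul, SubmonoidClass.coe_pow, ← h2]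
    ring
  rw [← top_le_iff]
  intro x _
  obtain ⟨y, rfl⟩ := (Proj.basicOpenIsoAway (grading k) (MvPolynomial.X i)
    (X_mem_grading i) one_pos).commRingCatIsoToRingEquiv.surjective x
  exact (hB ▸ Algebra.mem_top : y ∈ B)

/-- Writing the germs of both coordinates as explicit fractions in one localization makes the gluing
relation and `mem₀` visible. -/
lemma proj_stalk (i j : Fin 2) (p : projectiveLine k)
    (hp : p ∈ Proj.basicOpen (grading k) (MvPolynomial.X i)) :
    ((Proj.stalkIso (grading k) p).hom ((projectiveLine k).presheaf.germ _ p hp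
      (Proj.awayToSection (grading k) (MvPolynomial.X i) (projCoord k i j)))).val =
      Localization.mk (MvPolynomial.X j) ⟨MvPolynomial.X i, hp⟩ := by
  have h := ProjectiveSpectrum.Proj.awayToSection_germ (grading k) (MvPolynomial.X i) p hp
  have h1 := congr(($h) (projCoord k i j))
  have h2 : (Proj.stalkIso (grading k) p).hom ((projectiveLine k).presheaf.germ _ p hp
      (Proj.awayToSection (grading k) (MvPolynomial.X i) (projCoord k i j))) =
      HomogeneousLocalization.mapId (grading k) (Submonoid.powers_le.mpr hp)
        (projCoord k i j) := by
    refine (congrArg (Proj.stalkIso (grading k) p).hom h1).trans ?_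
    exact (Proj.stalkIso (grading k) p).commRingCatIsoToRingEquiv.apply_symm_apply _
  rw [h2]
  simp only [projCoord, HomogeneousLocalization.mapId, HomogeneousLocalization.Away.mk, pow_one]
  rfl

/-- The standard charts of the projective line. -/
def projChart (k : Type u) [Field k] : LineChart (projectiveLineToSpec k) where
  U₀ := Proj.basicOpen (grading k) (MvPolynomial.X 0)
  U₁ := Proj.basicOpen (grading k) (MvPolynomial.X 1)
  t := Proj.awayToSection (grading k) (MvPolynomial.X 0) (projCoord k 0 1)
  u := Proj.awayToSection (grading k) (MvPolynomial.X 1) (projCoord k 1 0)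
  affine₀ := Proj.isAffineOpen_basicOpen _ _ (X_mem_grading 0) one_pos
  affine₁ := Proj.isAffineOpen_basicOpen _ _ (X_mem_grading 1) one_pos
  cover p := by
    have h := Proj.iSup_basicOpen_eq_top' (grading k) (MvPolynomial.X : Fin 2 → _)
      (fun i => ⟨1, X_mem_grading i⟩) (by
        rw [← top_le_iff]
        intro p _
        induction p using MvPolynomial.induction_on with
        | C a => exact Subalgebra.algebraMap_mem _ (algebraMap k (grading k 0) a)
        | add p q hp hq => exact add_mem (hp trivial) (hq trivial)
        | mul_X p j hp => exact mul_mem (hp trivial) (Algebra.subset_adjoin ⟨j, rfl⟩))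
    have hp : p ∈ ⨆ i, Proj.basicOpen (grading k) (MvPolynomial.X i) := h ▸ trivial
    obtain ⟨i, hi⟩ := TopologicalSpace.Opens.mem_iSup.mp hp
    fin_cases i
    · exact Or.inl hi
    · exact Or.inr hi
  mul_eq p h₀ h₁ := by
    apply (Proj.stalkIso (grading k) p).commRingCatIsoToRingEquiv.injective
    apply HomogeneousLocalization.val_injective
    rw [map_mul, map_one, HomogeneousLocalization.val_mul, HomogeneousLocalization.val_one]
    refine (congrArg₂ (· * ·) (proj_stalk 0 1 p h₀) (proj_stalk 1 0 p h₁)).trans ?_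
    simp only [Localization.mk_mul]
    rw [← Localization.mk_one, Localization.mk_eq_mk_iff, Localization.r_iff_exists]
    exact ⟨1, by simp [mul_comm]⟩
  mem₀ p h₁ hu := by
    have h := (hu.map (Proj.stalkIso (grading k) p).hom.hom)
    have : p.asHomogeneousIdeal.toIdeal.IsPrime := ProjectiveSpectrum.isPrime p
    have h2 := h.map (algebraMap _ (Localization.AtPrime p.asHomogeneousIdeal.toIdeal))
    have h3 := proj_stalk 1 0 p h₁
    have h4 : IsUnit (Localization.mk (MvPolynomial.X 0) ⟨MvPolynomial.X 1, h₁⟩ :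
        Localization.AtPrime p.asHomogeneousIdeal.toIdeal) := h3 ▸ h2
    rw [Localization.mk_eq_mk', IsLocalization.AtPrime.isUnit_mk'_iff
      (Localization.AtPrime p.asHomogeneousIdeal.toIdeal) p.asHomogeneousIdeal.toIdeal] at h4
    exact h4
  gen₀ := proj_gen 0 1 (by decide)
  gen₁ := proj_gen 1 0 (by decide)

end ProjChart

/-! ### Forms on the projective line with prescribed zeros -/

section LinearForms

variable {K : Type*} [Field K] {R R' : Type*} [CommRing R] [CommRing R']

/-- The linear form on the projective line vanishing at the point with affine coordinate `c`,
where `none` stands for the point at infinity. -/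
def lin (κ : K →+* R) (c : Option K) (x y : R) : R :=
  c.elim x fun a => y - κ a * x

/-- The first homogeneous coordinate of a point of the projective line. -/
def homX (c : Option K) : K := c.elim 0 fun _ => 1

/-- The second homogeneous coordinate of a point of the projective line. -/
def homY (c : Option K) : K := c.elim 1 id

lemma map_lin (κ : K →+* R) (κ' : K →+* R') (f : R →+* R') (h : ∀ a, f (κ a) = κ' a)
    (c : Option K) (x y : R) : f (lin κ c x y) = lin κ' c (f x) (f y) := by
  cases c <;> simp [lin, h]

lemma lin_mul (κ : K →+* R) (c : Option K) (l x y : R) :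
    lin κ c (l * x) (l * y) = l * lin κ c x y := by
  cases c <;> simp [lin]; ring

lemma lin_hom_eq_zero_iff (c d : Option K) :
    lin (RingHom.id K) c (homX d) (homY d) = 0 ↔ d = c := by
  cases c <;> cases d <;> simp [lin, homX, homY, sub_eq_zero]

/-- A power of the product of the linear forms vanishing on a finite set. -/
def form (κ : K →+* R) (S : Finset (Option K)) (m : ℕ) (x y : R) : R :=
  (∏ c ∈ S, lin κ c x y) ^ m

lemma map_form (κ : K →+* R) (κ' : K →+* R') (f : R →+* R') (h : ∀ a, f (κ a) = κ' a)
    (S : Finset (Option K)) (m : ℕ) (x y : R) :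
    f (form κ S m x y) = form κ' S m (f x) (f y) := by
  simp [form, map_pow, map_prod, map_lin κ κ' f h]

/-- Homogeneity of degree `S.card * m`: quotients of forms of equal degree do not depend on the
choice of homogeneous coordinates. -/
lemma form_mul (κ : K →+* R) (S : Finset (Option K)) (m : ℕ) (l x y : R) :
    form κ S m (l * x) (l * y) = l ^ (S.card * m) * form κ S m x y := by
  simp only [form, lin_mul, Finset.prod_mul_distrib, Finset.prod_const, mul_pow, pow_mul]

lemma form_hom_eq_zero_iff (S : Finset (Option K)) {m : ℕ} (hm : m ≠ 0) (d : Option K) :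
    form (RingHom.id K) S m (homX d) (homY d) = 0 ↔ d ∈ S := by
  simp [form, pow_eq_zero_iff hm, Finset.prod_eq_zero_iff, lin_hom_eq_zero_iff]

end LinearForms

/-! ### Local homogeneous coordinates and coordinates of rational points -/

namespace LineChart

variable {K : Type u} [Field K] {P : Scheme.{u}} {q : P ⟶ SpecOf K} (C : LineChart q)

lemma mem₁ {p : P} (h : p ∉ C.U₀) : p ∈ C.U₁ := (C.cover p).resolve_left h

open Classical in
/-- The first local homogeneous coordinate at a point. -/
def cx (p : P) : P.presheaf.stalk p :=
  if h : p ∈ C.U₀ then 1 else P.presheaf.germ C.U₁ p (C.mem₁ h) C.u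

open Classical in
/-- The second local homogeneous coordinate at a point. -/
def cy (p : P) : P.presheaf.stalk p :=
  if h : p ∈ C.U₀ then P.presheaf.germ C.U₀ p h C.t else 1

lemma cx_or_cy (p : P) : C.cx p = 1 ∨ C.cy p = 1 := by
  by_cases h : p ∈ C.U₀ <;> simp [cx, cy, h]

/-- The chart used may change from `y` to `x`; the coordinates at the two points are nevertheless
proportional, by the gluing relation. -/
lemma specializes_cx_mul {x y : P} (h : x ⤳ y) :
    P.presheaf.stalkSpecializes h (C.cx y) * C.cy x =
      P.presheaf.stalkSpecializes h (C.cy y) * C.cx x := by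
  have g₀ : ∀ hy : y ∈ C.U₀, P.presheaf.stalkSpecializes h (P.presheaf.germ C.U₀ y hy C.t) =
      P.presheaf.germ C.U₀ x (h.mem_open C.U₀.2 hy) C.t := fun hy =>
    P.presheaf.germ_stalkSpecializes_apply _ _ _
  have g₁ : ∀ hy : y ∈ C.U₁, P.presheaf.stalkSpecializes h (P.presheaf.germ C.U₁ y hy C.u) =
      P.presheaf.germ C.U₁ x (h.mem_open C.U₁.2 hy) C.u := fun hy =>
    P.presheaf.germ_stalkSpecializes_apply _ _ _
  by_cases hy : y ∈ C.U₀
  · have hx : x ∈ C.U₀ := h.mem_open C.U₀.2 hy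
    rw [cx, cy, cx, cy, dif_pos hx, dif_pos hx, dif_pos hy, dif_pos hy, g₀, map_one, mul_comm]
  · have hx1 : x ∈ C.U₁ := h.mem_open C.U₁.2 (C.mem₁ hy)
    by_cases hx : x ∈ C.U₀
    · rw [cx, cy, cx, cy, dif_pos hx, dif_pos hx, dif_neg hy, dif_neg hy, g₁, map_one, mul_comm,
        C.mul_eq, mul_one]
    · rw [cx, cy, cx, cy, dif_neg hx, dif_neg hx, dif_neg hy, dif_neg hy, g₁, map_one, mul_comm]

section Points

open Classical in
/-- The coordinate of a `K`-point of the projective line. -/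
def coord (s : SpecOf K ⟶ P) : Option K :=
  if h : s (IsLocalRing.closedPoint K) ∈ C.U₀ then
    some (Scheme.stalkClosedPointTo s (P.presheaf.germ C.U₀ _ h C.t)) else none

variable (s : SpecOf K ⟶ P) (hs : s ≫ q = 𝟙 _)

include hs in
lemma ev_cx : Scheme.stalkClosedPointTo s (C.cx _) = homX (C.coord s) := by
  by_cases h : s (IsLocalRing.closedPoint K) ∈ C.U₀
  · rw [cx, coord, dif_pos h, dif_pos h, map_one]; rfl
  · rw [cx, coord, dif_neg h, dif_neg h]
    refine (retraction_eq_zero_iff (ev := (Scheme.stalkClosedPointTo s).hom)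
      (stalkClosedPointTo_scalStalk s hs) _).mpr ?_
    exact fun hu => h (C.mem₀ _ _ hu)

lemma ev_cy : Scheme.stalkClosedPointTo s (C.cy _) = homY (C.coord s) := by
  by_cases h : s (IsLocalRing.closedPoint K) ∈ C.U₀
  · rw [cy, coord, dif_pos h, dif_pos h]; rfl
  · rw [cy, coord, dif_neg h, dif_neg h, map_one]; rfl

end Points

/-- The maximal ideal of the local ring at a rational point of an affine line is generated by
`t - a`. -/
lemma maximalIdeal_stalk_eq_span_sub {U : P.Opens} (hU : IsAffineOpen U) (t : Γ(P, U))
    (gen : ∀ s : Subring Γ(P, U), (∀ a, scal q U a ∈ s) → t ∈ s → s = ⊤) (p : P) (hp : p ∈ U)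
    (ev : P.presheaf.stalk p →+* K) (hev : ∀ a, ev (scalStalk q p a) = a) :
    IsLocalRing.maximalIdeal (P.presheaf.stalk p) =
      Ideal.span {P.presheaf.germ U p hp t -
        scalStalk q p (ev (P.presheaf.germ U p hp t))} := by
  set a := ev (P.presheaf.germ U p hp t) with ha
  let := TopCat.Presheaf.algebra_section_stalk P.presheaf ⟨p, hp⟩
  have hloc := hU.isLocalization_stalk ⟨p, hp⟩
  have hq : ∀ y : Γ(P, U), y ∈ (hU.primeIdealOf ⟨p, hp⟩).asIdeal ↔
      ev (P.presheaf.germ U p hp y) = 0 := by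
    intro y
    rw [retraction_eq_zero_iff hev, hU.primeIdealOf_eq_map_closedPoint]
    rfl
  have hI : (hU.primeIdealOf ⟨p, hp⟩).asIdeal = Ideal.span {t - scal q U a} := by
    have key : ∀ y : Γ(P, U), y - scal q U (ev (P.presheaf.germ U p hp y)) ∈
        Ideal.span {t - scal q U a} := by
      let J : Ideal Γ(P, U) := Ideal.span {t - scal q U a}
      -- `e` replaces a function by its value at `p`. It agrees with the identity modulo `t - a` on
      -- constants and on `t`, hence everywhere.
      let e : Γ(P, U) →+* Γ(P, U) := (scal q U).comp (ev.comp (P.presheaf.germ U p hp).hom)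
      have h1 : RingHom.eqLocus (Ideal.Quotient.mk J) ((Ideal.Quotient.mk J).comp e) = ⊤ := by
        refine gen _ (fun b => ?_) ?_
        · change Ideal.Quotient.mk J _ = Ideal.Quotient.mk J
            (scal q U (ev (P.presheaf.germ U p hp (scal q U b))))
          rw [germ_scal, hev]
        · change Ideal.Quotient.mk J _ = Ideal.Quotient.mk J _
          rw [Ideal.Quotient.eq]
          exact Ideal.mem_span_singleton_self _
      intro y
      have h2 : y ∈ RingHom.eqLocus (Ideal.Quotient.mk J) ((Ideal.Quotient.mk J).comp e) :=
        h1 ▸ Subring.mem_top y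
      exact Ideal.Quotient.eq.mp h2
    apply le_antisymm
    · intro y hy
      have h := key y
      rwa [(hq y).mp hy, map_zero, sub_zero] at h
    · rw [Ideal.span_singleton_le_iff_mem, hq, map_sub, map_sub, germ_scal, hev, ← ha, sub_self]
  have h3 := IsLocalization.AtPrime.map_eq_maximalIdeal (hU.primeIdealOf ⟨p, hp⟩).asIdeal
    (P.presheaf.stalk p)
  rw [hI, Ideal.map_span, Set.image_singleton] at h3
  rw [← h3, map_sub]
  congr 3
  exact germ_scal q U p hp a

/-- The maximal ideal of the local ring at a rational point of the projective line is generated by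
the linear form vanishing at this point. -/
lemma maximalIdeal_stalk_eq_span (s : SpecOf K ⟶ P) (hs : s ≫ q = 𝟙 _) :
    IsLocalRing.maximalIdeal (P.presheaf.stalk (s (IsLocalRing.closedPoint K))) =
      Ideal.span {lin (scalStalk q _) (C.coord s) (C.cx _) (C.cy _)} := by
  by_cases h : s (IsLocalRing.closedPoint K) ∈ C.U₀
  · rw [cx, cy, coord, dif_pos h, dif_pos h, dif_pos h,
      maximalIdeal_stalk_eq_span_sub C.affine₀ C.t C.gen₀ _ h
      (Scheme.stalkClosedPointTo s).hom (stalkClosedPointTo_scalStalk s hs)]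
    simp only [lin, Option.elim, mul_one]
  · have h0 : Scheme.stalkClosedPointTo s (P.presheaf.germ C.U₁ _ (C.mem₁ h) C.u) = 0 := by
      refine (retraction_eq_zero_iff (ev := (Scheme.stalkClosedPointTo s).hom)
        (stalkClosedPointTo_scalStalk s hs) _).mpr ?_
      exact fun hu => h (C.mem₀ _ _ hu)
    have h1 := maximalIdeal_stalk_eq_span_sub C.affine₁ C.u C.gen₁ _ (C.mem₁ h)
      (Scheme.stalkClosedPointTo s).hom (stalkClosedPointTo_scalStalk s hs)
    rw [cx, cy, coord, dif_neg h, dif_neg h, dif_neg h]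
    refine h1.trans ?_
    simp only [lin, Option.elim]
    congr 2
    refine (congrArg (fun a => _ - scalStalk q _ a) h0).trans ?_
    rw [map_zero, sub_zero]

lemma eq_fromSpec {U : P.Opens} (hU : IsAffineOpen U) (s : SpecOf K ⟶ P)
    (h : s (IsLocalRing.closedPoint K) ∈ U) :
    s = Spec.map (P.presheaf.germ U _ h ≫ Scheme.stalkClosedPointTo s) ≫ hU.fromSpec := by
  conv_lhs => rw [← Scheme.Spec_stalkClosedPointTo_fromSpecStalk s,
    ← hU.fromSpecStalk_eq_fromSpecStalk h]
  rw [IsAffineOpen.fromSpecStalk, Spec.map_comp, Category.assoc]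

/-- A point of an affine open is an evaluation homomorphism, determined by its values on the
generators: the constants and `t`. -/
lemma eq_of_germ_eq {U : P.Opens} (hU : IsAffineOpen U) (t : Γ(P, U))
    (gen : ∀ s : Subring Γ(P, U), (∀ a, scal q U a ∈ s) → t ∈ s → s = ⊤)
    {s s' : SpecOf K ⟶ P} (hs : s ≫ q = 𝟙 _) (hs' : s' ≫ q = 𝟙 _)
    (h : s (IsLocalRing.closedPoint K) ∈ U) (h' : s' (IsLocalRing.closedPoint K) ∈ U)
    (ht : Scheme.stalkClosedPointTo s (P.presheaf.germ U _ h t) =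
      Scheme.stalkClosedPointTo s' (P.presheaf.germ U _ h' t)) : s = s' := by
  have h1 : RingHom.eqLocus (P.presheaf.germ U _ h ≫ Scheme.stalkClosedPointTo s).hom
      (P.presheaf.germ U _ h' ≫ Scheme.stalkClosedPointTo s').hom = ⊤ := by
    refine gen _ (fun a => ?_) ht
    change Scheme.stalkClosedPointTo s (P.presheaf.germ U _ h (scal q U a)) =
      Scheme.stalkClosedPointTo s' (P.presheaf.germ U _ h' (scal q U a))
    rw [germ_scal, germ_scal, stalkClosedPointTo_scalStalk s hs,
      stalkClosedPointTo_scalStalk s' hs']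
  rw [eq_fromSpec hU s h, eq_fromSpec hU s' h']
  congr 2
  exact CommRingCat.hom_ext (RingHom.ext fun y => (h1 ▸ Subring.mem_top y :
    y ∈ RingHom.eqLocus (P.presheaf.germ U _ h ≫ Scheme.stalkClosedPointTo s).hom
      (P.presheaf.germ U _ h' ≫ Scheme.stalkClosedPointTo s').hom))

lemma coord_injective {s s' : SpecOf K ⟶ P} (hs : s ≫ q = 𝟙 _) (hs' : s' ≫ q = 𝟙 _)
    (h : C.coord s = C.coord s') : s = s' := by
  by_cases h₀ : s (IsLocalRing.closedPoint K) ∈ C.U₀ <;>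
    by_cases h₀' : s' (IsLocalRing.closedPoint K) ∈ C.U₀
  · rw [coord, coord, dif_pos h₀, dif_pos h₀', Option.some_inj] at h
    exact eq_of_germ_eq C.affine₀ C.t C.gen₀ hs hs' h₀ h₀' h
  · simp [coord, h₀, h₀'] at h
  · simp [coord, h₀, h₀'] at h
  · refine eq_of_germ_eq C.affine₁ C.u C.gen₁ hs hs' (C.mem₁ h₀) (C.mem₁ h₀') ?_
    have h1 := C.ev_cx s hs
    have h2 := C.ev_cx s' hs'
    rw [cx, dif_neg h₀] at h1
    rw [cx, dif_neg h₀'] at h2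
    rw [h1, h2, h]

end LineChart

/-! ### Pullbacks of forms along morphisms to the line -/

/-- Two proportional pairs over a field, one of them non-zero. -/
lemma exists_eq_mul_of_mul_eq {L : Type*} [Field L] {x y a b : L} (h : x * b = y * a)
    (hxy : x ≠ 0 ∨ y ≠ 0) (hab : a ≠ 0 ∨ b ≠ 0) : ∃ l, l ≠ 0 ∧ x = l * a ∧ y = l * b := by
  by_cases ha : a = 0
  · subst ha
    have hb : b ≠ 0 := by simpa using hab
    have hx : x = 0 := by simpa [hb] using h
    refine ⟨y / b, div_ne_zero (by simpa [hx] using hxy) hb, by simp [hx], by field_simp⟩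
  · have hx : x ≠ 0 := by
      rintro rfl
      have : y = 0 := by simpa [ha] using h.symm
      simp [this] at hxy
    refine ⟨x / a, div_ne_zero hx ha, by field_simp, ?_⟩
    rw [div_mul_eq_mul_div, eq_div_iff ha, h]

namespace LineChart

variable {K : Type u} [Field K] {E X P : Scheme.{u}} {q : P ⟶ SpecOf K} (C : LineChart q)

/-- The first homogeneous coordinate of a morphism to the projective line, near a point. -/
def pullX (φ : X ⟶ P) (x : X) : X.presheaf.stalk x := φ.stalkMap x (C.cx (φ x))

/-- The second homogeneous coordinate of a morphism to the projective line, near a point. -/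
def pullY (φ : X ⟶ P) (x : X) : X.presheaf.stalk x := φ.stalkMap x (C.cy (φ x))

lemma pullX_or_pullY (φ : X ⟶ P) (x : X) : C.pullX φ x = 1 ∨ C.pullY φ x = 1 := by
  rcases C.cx_or_cy (φ x) with h | h
  · left; rw [pullX, h, map_one]
  · right; rw [pullY, h, map_one]

lemma pullX_comp (j : E ⟶ X) (φ : X ⟶ P) (x : E) :
    C.pullX (j ≫ φ) x = j.stalkMap x (C.pullX φ (j x)) :=
  congr(($(Scheme.Hom.stalkMap_comp j φ x)) (C.cx (φ (j x))))

lemma pullY_comp (j : E ⟶ X) (φ : X ⟶ P) (x : E) :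
    C.pullY (j ≫ φ) x = j.stalkMap x (C.pullY φ (j x)) :=
  congr(($(Scheme.Hom.stalkMap_comp j φ x)) (C.cy (φ (j x))))

lemma specializes_pullX_mul (φ : X ⟶ P) {x y : X} (h : x ⤳ y) :
    X.presheaf.stalkSpecializes h (C.pullX φ y) * C.pullY φ x =
      X.presheaf.stalkSpecializes h (C.pullY φ y) * C.pullX φ x := by
  have h1 := Scheme.Hom.stalkSpecializes_stalkMap φ x y h
  have hX := congr(($h1) (C.cx (φ y)))
  have hY := congr(($h1) (C.cy (φ y)))
  have h2 := congrArg (φ.stalkMap x) (C.specializes_cx_mul (h.map φ.continuous))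
  rw [map_mul, map_mul] at h2
  refine Eq.trans (congrArg (· * C.pullY φ x) hX.symm) (h2.trans ?_)
  exact congrArg (· * C.pullX φ x) hY

section FunctionField

variable [IsIntegral E]

lemma exists_generic (φ : E ⟶ P) (x : E) :
    ∃ l : E.functionField, l ≠ 0 ∧
      algebraMap (E.presheaf.stalk x) E.functionField (C.pullX φ x) =
        l * C.pullX φ (genericPoint E) ∧
      algebraMap (E.presheaf.stalk x) E.functionField (C.pullY φ x) =
        l * C.pullY φ (genericPoint E) := by
  apply exists_eq_mul_of_mul_eq
  · exact C.specializes_pullX_mul φ ((genericPoint_spec E).specializes trivial)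
  · rcases C.pullX_or_pullY φ x with h | h <;> simp [h]
  · rcases C.pullX_or_pullY φ (genericPoint E) with h | h <;> simp [h]

lemma algebraMap_scalStalk (f : E ⟶ SpecOf K) (x : E) (a : K) :
    algebraMap (E.presheaf.stalk x) E.functionField (scalStalk f x a) =
      scalStalk f (genericPoint E) a :=
  stalkSpecializes_scalStalk f _ a

/-- One scaling factor `l` serves all forms at once, so it cancels between forms of equal degree. -/
lemma exists_form_generic (f : E ⟶ SpecOf K) (φ : E ⟶ P) (x : E) :
    ∃ l : E.functionField, l ≠ 0 ∧ ∀ (S : Finset (Option K)) (m : ℕ),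
      algebraMap (E.presheaf.stalk x) E.functionField
        (form (scalStalk f x) S m (C.pullX φ x) (C.pullY φ x)) =
      l ^ (S.card * m) * form (scalStalk f (genericPoint E)) S m
        (C.pullX φ (genericPoint E)) (C.pullY φ (genericPoint E)) := by
  obtain ⟨l, hl, hx, hy⟩ := C.exists_generic φ x
  refine ⟨l, hl, fun S m => ?_⟩
  rw [map_form _ _ _ (algebraMap_scalStalk f x), hx, hy, form_mul]

/-- On an integral scheme a linear form that is nonzero at one stalk is nonzero at the generic
point, hence in every stalk. -/
lemma form_ne_zero (f : E ⟶ SpecOf K) (φ : E ⟶ P)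
    (hφ : ∀ c, ∃ x, lin (scalStalk f x) c (C.pullX φ x) (C.pullY φ x) ≠ 0) (x : E)
    (S : Finset (Option K)) (m : ℕ) :
    form (scalStalk f x) S m (C.pullX φ x) (C.pullY φ x) ≠ 0 := by
  rw [form]
  refine pow_ne_zero _ (Finset.prod_ne_zero_iff.mpr fun c _ h0 => ?_)
  obtain ⟨y, hy⟩ := hφ c
  obtain ⟨l, hl, hlf⟩ := C.exists_form_generic f φ x
  obtain ⟨l', hl', hlf'⟩ := C.exists_form_generic f φ y
  have h1 := hlf {c} 1
  have h2 := hlf' {c} 1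
  simp only [form, Finset.prod_singleton, pow_one, Finset.card_singleton, mul_one] at h1 h2
  rw [h0, map_zero, eq_comm, mul_eq_zero_iff_left hl] at h1
  rw [h1, mul_zero] at h2
  exact hy ((IsFractionRing.injective (E.presheaf.stalk y) E.functionField)
    (h2.trans (map_zero _).symm))

/-- Two pairs of forms of the same bidegree on a proper curve with the same divisor differ by
a constant. -/
lemma exists_form_mul_eq [IsAlgClosed K] (f : E ⟶ SpecOf K) [UniversallyClosed f] (φ ψ : E ⟶ P)
    (hφ : ∀ c, ∃ x, lin (scalStalk f x) c (C.pullX φ x) (C.pullY φ x) ≠ 0)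
    (hψ : ∀ c, ∃ x, lin (scalStalk f x) c (C.pullX ψ x) (C.pullY ψ x) ≠ 0)
    (S T : Finset (Option K)) (m n : ℕ) (hd : S.card * m = T.card * n)
    (hS : ∀ x : E, IsClosed {x} →
      Associated (form (scalStalk f x) S m (C.pullX φ x) (C.pullY φ x))
        (form (scalStalk f x) S m (C.pullX ψ x) (C.pullY ψ x)))
    (hT : ∀ x : E, IsClosed {x} →
      Associated (form (scalStalk f x) T n (C.pullX φ x) (C.pullY φ x))
        (form (scalStalk f x) T n (C.pullX ψ x) (C.pullY ψ x))) :
    ∃ c : K, c ≠ 0 ∧ ∀ x : E,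
      form (scalStalk f x) S m (C.pullX φ x) (C.pullY φ x) *
        form (scalStalk f x) T n (C.pullX ψ x) (C.pullY ψ x) =
      scalStalk f x c * (form (scalStalk f x) S m (C.pullX ψ x) (C.pullY ψ x) *
        form (scalStalk f x) T n (C.pullX φ x) (C.pullY φ x)) := by
  set η := genericPoint E
  let A := form (scalStalk f η) S m (C.pullX φ η) (C.pullY φ η) *
        form (scalStalk f η) T n (C.pullX ψ η) (C.pullY ψ η)
  let B := form (scalStalk f η) S m (C.pullX ψ η) (C.pullY ψ η) *
        form (scalStalk f η) T n (C.pullX φ η) (C.pullY φ η)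
  have hA : A ≠ 0 := mul_ne_zero (C.form_ne_zero f φ hφ η S m) (C.form_ne_zero f ψ hψ η T n)
  have hB : B ≠ 0 := mul_ne_zero (C.form_ne_zero f ψ hψ η S m) (C.form_ne_zero f φ hφ η T n)
  have key : ∀ x : E, ∃ l : E.functionField, l ≠ 0 ∧
      algebraMap (E.presheaf.stalk x) E.functionField
        (form (scalStalk f x) S m (C.pullX φ x) (C.pullY φ x) *
        form (scalStalk f x) T n (C.pullX ψ x) (C.pullY ψ x)) = l * A ∧
      algebraMap (E.presheaf.stalk x) E.functionField
        (form (scalStalk f x) S m (C.pullX ψ x) (C.pullY ψ x) *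
        form (scalStalk f x) T n (C.pullX φ x) (C.pullY φ x)) = l * B := by
    intro x
    obtain ⟨l, hl, hlf⟩ := C.exists_form_generic f φ x
    obtain ⟨l', hl', hlf'⟩ := C.exists_form_generic f ψ x
    refine ⟨l ^ (S.card * m) * l' ^ (S.card * m), mul_ne_zero (pow_ne_zero _ hl)
      (pow_ne_zero _ hl'), ?_, ?_⟩
    · rw [map_mul, hlf, hlf', ← hd]; ring
    · rw [map_mul, hlf, hlf', ← hd]; ring
  -- At a closed point both products of forms are associated and carry the same factor `l`, so `A /
  -- B` is regular there.
  obtain ⟨c, hc⟩ := exists_scalStalk_eq_of_regular f (A / B) (fun x hx => by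
    obtain ⟨l, hl, h1, h2⟩ := key x
    obtain ⟨w, hw⟩ := (hS x hx).symm.mul_mul (hT x hx)
    refine ⟨w, ?_⟩
    rw [div_eq_mul_inv, eq_mul_inv_iff_mul_eq₀ hB]
    apply mul_left_cancel₀ hl
    rw [← h1, mul_left_comm, ← h2, ← map_mul, mul_comm, hw])
  have hcB : scalStalk f η c * B = A := by rw [hc, div_mul_cancel₀ _ hB]
  refine ⟨c, ?_, fun x => ?_⟩
  · rintro rfl
    rw [map_zero, zero_mul] at hcB
    exact hA hcB.symm
  · apply IsFractionRing.injective (E.presheaf.stalk x) E.functionField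
    obtain ⟨l, hl, h1, h2⟩ := key x
    rw [h1, map_mul, h2, algebraMap_scalStalk, ← hcB]
    ring

end FunctionField

/-! ### Pulled-back forms at rational points and ramification -/

section RationalPoints

variable {f : X ⟶ SpecOf K} (φ : X ⟶ P) (s : SpecOf K ⟶ X) (hs : s ≫ f = 𝟙 _)

lemma stalkClosedPointTo_stalkMap (y : P.presheaf.stalk (φ (s (IsLocalRing.closedPoint K)))) :
    Scheme.stalkClosedPointTo s (φ.stalkMap _ y) = Scheme.stalkClosedPointTo (s ≫ φ) y := by
  have h := Scheme.stalkClosedPointTo_comp s φ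
  exact congr(($h) y).symm

variable (hφ : φ ≫ q = f)

include hs hφ in
lemma comp_section : (s ≫ φ) ≫ q = 𝟙 _ := by rw [Category.assoc, hφ, hs]

include hs hφ in
lemma ev_lin (c : Option K) :
    Scheme.stalkClosedPointTo s (lin (scalStalk f _) c (C.pullX φ _) (C.pullY φ _)) =
      lin (RingHom.id K) c (homX (C.coord (s ≫ φ))) (homY (C.coord (s ≫ φ))) := by
  refine (map_lin _ (RingHom.id K) (Scheme.stalkClosedPointTo s).hom
    (stalkClosedPointTo_scalStalk s hs) _ _ _).trans ?_
  have h1 := (stalkClosedPointTo_stalkMap φ s (C.cx _)).trans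
    (C.ev_cx (s ≫ φ) (comp_section φ s hs hφ))
  have h2 := (stalkClosedPointTo_stalkMap φ s (C.cy _)).trans (C.ev_cy (s ≫ φ))
  exact congrArg₂ _ h1 h2

include hs hφ in
lemma ev_form (S : Finset (Option K)) (m : ℕ) :
    Scheme.stalkClosedPointTo s (form (scalStalk f _) S m (C.pullX φ _) (C.pullY φ _)) =
      form (RingHom.id K) S m (homX (C.coord (s ≫ φ))) (homY (C.coord (s ≫ φ))) := by
  refine (map_form _ (RingHom.id K) (Scheme.stalkClosedPointTo s).hom
    (stalkClosedPointTo_scalStalk s hs) _ _ _ _).trans ?_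
  have h1 := (stalkClosedPointTo_stalkMap φ s (C.cx _)).trans
    (C.ev_cx (s ≫ φ) (comp_section φ s hs hφ))
  have h2 := (stalkClosedPointTo_stalkMap φ s (C.cy _)).trans (C.ev_cy (s ≫ φ))
  exact congrArg₂ _ h1 h2

include hs hφ in
lemma isUnit_lin (c : Option K) (h : C.coord (s ≫ φ) ≠ c) :
    IsUnit (lin (scalStalk f (s (IsLocalRing.closedPoint K))) c (C.pullX φ _) (C.pullY φ _)) := by
  by_contra hu
  have h1 := (retraction_eq_zero_iff (ev := (Scheme.stalkClosedPointTo s).hom)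
      (stalkClosedPointTo_scalStalk s hs) _).mpr hu
  exact h ((lin_hom_eq_zero_iff _ _).mp ((C.ev_lin φ s hs hφ c).symm.trans h1))

-- Among the linear factors only the one vanishing at the image point is a non-unit, so the form has
-- the order of vanishing of that factor.
include hs hφ in
lemma associated_form_lin (S : Finset (Option K)) (h : C.coord (s ≫ φ) ∈ S) :
    Associated (∏ c ∈ S, lin (scalStalk f (s (IsLocalRing.closedPoint K))) c
      (C.pullX φ _) (C.pullY φ _))
      (lin (scalStalk f (s (IsLocalRing.closedPoint K))) (C.coord (s ≫ φ))
      (C.pullX φ _) (C.pullY φ _)) := by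
  classical
  rw [← Finset.mul_prod_erase S _ h]
  refine associated_mul_unit_left _ _ ?_
  rw [IsUnit.prod_iff]
  intro c hc
  exact C.isUnit_lin φ s hs hφ c (Finset.ne_of_mem_erase hc).symm

-- This identifies the ramification index with the order of vanishing of the pulled-back linear
-- form.
include hs hφ in
lemma map_maximalIdeal :
    letI := (φ.stalkMap (s (IsLocalRing.closedPoint K))).hom.toAlgebra
    (IsLocalRing.maximalIdeal (P.presheaf.stalk (φ (s (IsLocalRing.closedPoint K))))).map
      (algebraMap _ (X.presheaf.stalk (s (IsLocalRing.closedPoint K)))) =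
    Ideal.span {lin (scalStalk f (s (IsLocalRing.closedPoint K))) (C.coord (s ≫ φ))
      (C.pullX φ _) (C.pullY φ _)} := by
  have h := C.maximalIdeal_stalk_eq_span (s ≫ φ) (comp_section φ s hs hφ)
  refine (congrArg (Ideal.map (φ.stalkMap (s (IsLocalRing.closedPoint K))).hom) h).trans ?_
  refine (Ideal.map_span _ _).trans ?_
  refine (congrArg Ideal.span Set.image_singleton).trans ?_
  exact congrArg (fun a => Ideal.span {a})
    (map_lin _ _ (φ.stalkMap _).hom (stalkMap_scalStalk φ hφ _) _ _ _)

include hs in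
/-- The local equations at a rational point of a form with zeros in `S`, pulled back along two
morphisms with equal ramification indices, are associated. -/
lemma associated_form [SmoothOfRelativeDimension 1 f] (ψ : X ⟶ P) (hφ : φ ≫ q = f)
    (hψ : ψ ≫ q = f) (S : Finset (Option K)) (m : ℕ)
    (h0φ : ∀ c, lin (scalStalk f (s (IsLocalRing.closedPoint K))) c
      (C.pullX φ _) (C.pullY φ _) ≠ 0)
    (h0ψ : ∀ c, lin (scalStalk f (s (IsLocalRing.closedPoint K))) c
      (C.pullX ψ _) (C.pullY ψ _) ≠ 0)
    (hS : C.coord (s ≫ φ) ∈ S ↔ C.coord (s ≫ ψ) ∈ S)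
    (he : C.coord (s ≫ φ) ∈ S → C.coord (s ≫ ψ) ∈ S →
      ramificationIndexAt φ (s (IsLocalRing.closedPoint K)) =
        ramificationIndexAt ψ (s (IsLocalRing.closedPoint K))) :
    Associated
      (form (scalStalk f (s (IsLocalRing.closedPoint K))) S m (C.pullX φ _) (C.pullY φ _))
      (form (scalStalk f (s (IsLocalRing.closedPoint K))) S m (C.pullX ψ _) (C.pullY ψ _)) := by
  refine Associated.pow_pow ?_
  by_cases h : C.coord (s ≫ φ) ∈ S
  · refine (C.associated_form_lin φ s hs hφ S h).trans (Associated.trans ?_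
      (C.associated_form_lin ψ s hs hψ S (hS.mp h)).symm)
    have : Smooth f := SmoothOfRelativeDimension.smooth 1 f
    have : IsLocallyNoetherian X := LocallyOfFiniteType.isLocallyNoetherian f
    obtain ⟨hdom, t, ht0, ht⟩ := exists_maximalIdeal_stalk_eq_span f
      (s (IsLocalRing.closedPoint K)) (Scheme.stalkClosedPointTo s).hom
      (stalkClosedPointTo_scalStalk s hs)
    let a₁ := (φ.stalkMap (s (IsLocalRing.closedPoint K))).hom.toAlgebra
    let a₂ := (ψ.stalkMap (s (IsLocalRing.closedPoint K))).hom.toAlgebra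
    exact associated_of_ramificationIdx'_eq ht0 ht _ _ (h0φ _) (h0ψ _)
      (C.map_maximalIdeal φ s hs hφ) (C.map_maximalIdeal ψ s hs hψ) (he h (hS.mp h))
  · have h' := fun h2 => h (hS.mpr h2)
    refine (associated_one_iff_isUnit.mpr ?_).trans (associated_one_iff_isUnit.mpr ?_).symm
    · exact IsUnit.prod_iff.mpr fun c hc => C.isUnit_lin φ s hs hφ c (fun e => h (e ▸ hc))
    · exact IsUnit.prod_iff.mpr fun c hc => C.isUnit_lin ψ s hs hψ c (fun e => h' (e ▸ hc))

end RationalPoints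

end LineChart

/-! ### Properness of the line, points over `K` and base change -/

instance isProper_projectiveLineToSpec (k : Type u) [Field k] :
    IsProper (projectiveLineToSpec k) := by
  let 𝒜 := MvPolynomial.homogeneousSubmodule (Fin 2) k
  let := MvPolynomial.gradedAlgebra (σ := Fin 2) (R := k)
  have h1 : Function.Surjective (algebraMap k (𝒜 0)) := by
    rintro ⟨x, hx⟩
    rw [MvPolynomial.mem_homogeneousSubmodule, ← MvPolynomial.totalDegree_zero_iff_isHomogeneous,
      MvPolynomial.totalDegree_eq_zero_iff_eq_C] at hx
    exact ⟨x.coeff 0, Subtype.ext hx.symm⟩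
  have h2 : IsClosedImmersion (Spec.map (CommRingCat.ofHom (algebraMap k (𝒜 0)))) :=
    IsClosedImmersion.spec_of_surjective _ h1
  have : IsScalarTower k (𝒜 0) (MvPolynomial (Fin 2) k) :=
    ⟨fun a b c => smul_mul_assoc a (b : MvPolynomial (Fin 2) k) c⟩
  have h3 : Algebra.FiniteType (𝒜 0) (MvPolynomial (Fin 2) k) :=
    Algebra.FiniteType.of_restrictScalars_finiteType k _ _
  have h4 : IsProper (Proj.toSpecZero 𝒜) := inferInstance
  exact inferInstanceAs (IsProper (Proj.toSpecZero 𝒜 ≫ _))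

section Points

variable {k : Type u} [Field k] {K : Type u} [Field K] [Algebra k K] {X Y Z : Scheme.{u}}
  {x : X ⟶ SpecOf k} {y : Y ⟶ SpecOf k} {z : Z ⟶ SpecOf k}

lemma Points.lift_fst (p : Points K x) : p.lift ≫ pullback.fst x (specMap k K) = p.1 :=
  pullback.lift_fst _ _ _

lemma Points.lift_snd (p : Points K x) : p.lift ≫ pullback.snd x (specMap k K) = 𝟙 _ :=
  pullback.lift_snd _ _ _

lemma Points.lift_injective : Function.Injective (Points.lift (K := K) (x := x)) := by
  intro p p' h
  apply Subtype.ext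
  rw [← p.lift_fst, h, p'.lift_fst]

lemma Points.exists_lift_eq (s : SpecOf K ⟶ baseChange K x)
    (hs : s ≫ pullback.snd x (specMap k K) = 𝟙 _) : ∃ p : Points K x, p.lift = s := by
  refine ⟨⟨s ≫ pullback.fst x (specMap k K), ?_⟩, ?_⟩
  · rw [Category.assoc, pullback.condition, reassoc_of% hs]
  · apply pullback.hom_ext
    · exact Points.lift_fst _
    · exact (Points.lift_snd _).trans hs.symm

lemma baseChangeMap_fst (f : X ⟶ Y) (hf : f ≫ y = x) :
    baseChangeMap K f hf ≫ pullback.fst y (specMap k K) = pullback.fst x (specMap k K) ≫ f :=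
  pullback.lift_fst _ _ _

lemma baseChangeMap_snd (f : X ⟶ Y) (hf : f ≫ y = x) :
    baseChangeMap K f hf ≫ pullback.snd y (specMap k K) = pullback.snd x (specMap k K) :=
  pullback.lift_snd _ _ _

lemma Points.lift_map (f : X ⟶ Y) (hf : f ≫ y = x) (p : Points K x) :
    (p.map f hf).lift = p.lift ≫ baseChangeMap K f hf := by
  apply pullback.hom_ext
  · rw [Category.assoc, baseChangeMap_fst, Points.lift_fst, reassoc_of% p.lift_fst]; rfl
  · rw [Category.assoc, baseChangeMap_snd, Points.lift_snd, p.lift_snd]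

lemma baseChangeMap_comp (g : Z ⟶ X) (hg : g ≫ x = z) (f : X ⟶ Y) (hf : f ≫ y = x)
    (h : (g ≫ f) ≫ y = z) :
    baseChangeMap K (g ≫ f) h = baseChangeMap K g hg ≫ baseChangeMap K f hf := by
  apply pullback.hom_ext
  · rw [Category.assoc, baseChangeMap_fst, baseChangeMap_fst, reassoc_of% (baseChangeMap_fst g hg)]
  · rw [Category.assoc, baseChangeMap_snd, baseChangeMap_snd, baseChangeMap_snd]

lemma isPullback_baseChangeMap (f : X ⟶ Y) (hf : f ≫ y = x) :
    IsPullback (pullback.fst x (specMap k K)) (baseChangeMap K f hf) f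
      (pullback.fst y (specMap k K)) := by
  refine (IsPullback.of_right (h₁₁ := baseChangeMap K f hf)
    (h₁₂ := pullback.snd y (specMap k K)) (v₁₁ := pullback.fst x (specMap k K))
    (h₂₁ := f) (h₂₂ := y) (v₁₃ := specMap k K) ?_ (baseChangeMap_fst f hf)
    (IsPullback.of_hasPullback y (specMap k K)).flip).flip
  rw [baseChangeMap_snd, hf]
  exact (IsPullback.of_hasPullback x (specMap k K)).flip

variable [IsAlgClosed K]

/-- A closed point of the base change to an algebraically closed field is a rational point. -/
lemma Points.exists_toBaseChange_eq [LocallyOfFiniteType x] {a : baseChange K x}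
    (ha : IsClosed {a}) : ∃ p : Points K x, p.toBaseChange = a := by
  have : LocallyOfFiniteType (pullback.snd x (specMap k K)) :=
    MorphismProperty.IsStableUnderBaseChange.of_isPullback
      (IsPullback.of_hasPullback x (specMap k K)) inferInstance
  obtain ⟨s, hs, rfl⟩ := exists_retraction_of_isClosed (pullback.snd x (specMap k K)) ha
  obtain ⟨p, rfl⟩ := Points.exists_lift_eq s hs
  exact ⟨p, rfl⟩

lemma Points.toBaseChange_injective [LocallyOfFiniteType x] :
    Function.Injective (Points.toBaseChange (K := K) (x := x)) := by
  intro p p' h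
  have : LocallyOfFiniteType (pullback.snd x (specMap k K)) :=
    MorphismProperty.IsStableUnderBaseChange.of_isPullback
      (IsPullback.of_hasPullback x (specMap k K)) inferInstance
  exact Points.lift_injective
    (ext_of_apply_closedPoint_eq (pullback.snd x (specMap k K)) p.lift_snd p'.lift_snd h)

lemma Points.isClosed_toBaseChange [LocallyOfFiniteType x] (p : Points K x) :
    IsClosed {p.toBaseChange} := by
  have : LocallyOfFiniteType (pullback.snd x (specMap k K)) :=
    MorphismProperty.IsStableUnderBaseChange.of_isPullback
      (IsPullback.of_hasPullback x (specMap k K)) inferInstance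
  exact (pointEquivClosedPoint (pullback.snd x (specMap k K)) ⟨p.lift, p.lift_snd⟩).2

/-- A dominant morphism of proper schemes is surjective on points with values in an algebraically
closed field. -/
lemma Points.map_surjective [IsProper x] [IsProper y] (f : X ⟶ Y) (hf : f ≫ y = x)
    [IsDominant f] : Function.Surjective (Points.map (K := K) f hf) := by
  intro p
  have hu : UniversallyClosed (f ≫ y) := by rw [hf]; infer_instance
  have hu2 : UniversallyClosed f := UniversallyClosed.of_comp_of_isSeparated f y
  have hs : Surjective f := inferInstance
  have hs2 : Surjective (baseChangeMap K f hf) :=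
    MorphismProperty.IsStableUnderBaseChange.of_isPullback (isPullback_baseChangeMap f hf) hs
  have hp : IsProper (pullback.snd x (specMap k K)) :=
    MorphismProperty.IsStableUnderBaseChange.of_isPullback
      (IsPullback.of_hasPullback x (specMap k K)) inferInstance
  have : CompactSpace (baseChange K x) :=
    (quasiCompact_iff_compactSpace (pullback.snd x (specMap k K))).mp inferInstance
  -- The fibre is nonempty and closed in a quasi-compact space, so it has a closed point, which is
  -- rational.
  obtain ⟨a, ha, hac⟩ := (p.isClosed_toBaseChange.preimage
    (baseChangeMap K f hf).continuous).exists_closed_singleton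
    (hs2.surj.nonempty_preimage.mpr (Set.singleton_nonempty _))
  obtain ⟨w, rfl⟩ := Points.exists_toBaseChange_eq hac
  refine ⟨w, Points.toBaseChange_injective ?_⟩
  rw [Points.toBaseChange, Points.lift_map]
  exact ha

end Points

/-! ### Comparison of the two pullbacks on one component -/

section Component

variable {k : Type u} [Field k] {K : Type u} [Field K] [Algebra k K]
  {P X : Scheme.{u}} {q : P ⟶ SpecOf k} {d : X ⟶ SpecOf k}

/-- The coordinate of a `K`-point of a projective line over `k`. -/
def LineChart.ptCoord (C : LineChart q) (p : Points K q) : Option K :=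
  (C.baseChange K q).coord p.lift

lemma LineChart.ptCoord_injective (C : LineChart q) :
    Function.Injective (C.ptCoord (K := K)) := fun p p' h =>
  Points.lift_injective ((C.baseChange K q).coord_injective p.lift_snd p'.lift_snd h)

lemma isProper_ι_comp [IsProper d] (U : X.Opens) (hU : IsClosed (U : Set X)) :
    IsProper (U.ι ≫ d) := by
  have : IsClosedImmersion U.ι := IsClosedImmersion.of_isPreimmersion _ (by simpa using hU)
  infer_instance

lemma smooth_snd [SmoothOfRelativeDimension 1 d] :
    SmoothOfRelativeDimension 1 (pullback.snd d (specMap k K)) :=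
  (smoothOfRelativeDimension_isStableUnderBaseChange 1).of_isPullback
    (IsPullback.of_hasPullback d (specMap k K)) inferInstance

variable [IsAlgClosed K]

/-- Irreducibility is geometric by hypothesis; reducedness comes from the smooth scheme `X_K`, of
which this is an open subscheme. -/
lemma isIntegral_baseChange [SmoothOfRelativeDimension 1 d] (U : X.Opens)
    [GeometricallyIrreducible (U.ι ≫ d)] : IsIntegral (baseChange K (U.ι ≫ d)) := by
  have h1 : IrreducibleSpace (baseChange K (U.ι ≫ d)) :=
    GeometricallyIrreducible.geometrically_irreducibleSpace (f := U.ι ≫ d) _ _ _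
      (IsPullback.of_hasPullback _ _)
  have h2 : SmoothOfRelativeDimension 1 (pullback.snd d (specMap k K)) := smooth_snd
  have h3 : IsReduced (baseChange K d) :=
    isReduced_of_smoothOfRelativeDimension_one (pullback.snd d (specMap k K))
  have h4 : IsOpenImmersion (baseChangeMap K U.ι (rfl : U.ι ≫ d = U.ι ≫ d)) :=
    MorphismProperty.IsStableUnderBaseChange.of_isPullback
      (isPullback_baseChangeMap U.ι (rfl : U.ι ≫ d = U.ι ≫ d)) inferInstance
  have h5 : IsReduced (baseChange K (U.ι ≫ d)) :=
    isReduced_of_isOpenImmersion (baseChangeMap K U.ι (rfl : U.ι ≫ d = U.ι ≫ d))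
  exact isIntegral_of_irreducibleSpace_of_isReduced _

/-- Some point of the line has coordinate other than `c`; above it, by surjectivity, the form is a
unit. -/
lemma exists_lin_ne_zero [Nontrivial (Points K q)] [IsProper q] [IsProper d] (C : LineChart q)
    (π : X ⟶ P) (hπ : π ≫ q = d) [IsDominant π] (c : Option K) :
    ∃ a, lin (scalStalk (pullback.snd d (specMap k K)) a) c
      ((C.baseChange K q).pullX (baseChangeMap K π hπ) a)
      ((C.baseChange K q).pullY (baseChangeMap K π hπ) a) ≠ 0 := by
  obtain ⟨p, hp⟩ : ∃ p : Points K q, C.ptCoord p ≠ c := by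
    obtain ⟨p, p', h⟩ := exists_pair_ne (Points K q)
    by_contra! hcon
    exact h (C.ptCoord_injective ((hcon p).trans (hcon p').symm))
  obtain ⟨w, rfl⟩ := Points.map_surjective π hπ p
  rw [LineChart.ptCoord, Points.lift_map] at hp
  exact ⟨_, ((C.baseChange K q).isUnit_lin (baseChangeMap K π hπ) w.lift w.lift_snd
    (baseChangeMap_snd π hπ) c hp).ne_zero⟩

/-- On a geometrically irreducible component of a proper smooth curve with two morphisms to the
projective line, the pullbacks of a rational function with divisor supported on equiramified
sets stable under the correspondence differ by a constant. -/
lemma exists_form_eq_of_component [Nontrivial (Points K q)] [IsProper q] [IsProper d]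
    [SmoothOfRelativeDimension 1 d] (C : LineChart q) (π₁ π₂ : X ⟶ P) (h₁ : π₁ ≫ q = d)
    (h₂ : π₂ ≫ q = d) (U : X.Opens) (hU : IsClosed (U : Set X))
    [GeometricallyIrreducible (U.ι ≫ d)] [IsDominant (U.ι ≫ π₁)] [IsDominant (U.ι ≫ π₂)]
    (S T : Finset (Option K)) (m n : ℕ) (hd : S.card * m = T.card * n)
    (hS : ∀ z : Points K d, C.ptCoord (z.map π₁ h₁) ∈ S ↔ C.ptCoord (z.map π₂ h₂) ∈ S)
    (hT : ∀ z : Points K d, C.ptCoord (z.map π₁ h₁) ∈ T ↔ C.ptCoord (z.map π₂ h₂) ∈ T)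
    (hSe : ∀ z : Points K d, C.ptCoord (z.map π₁ h₁) ∈ S → C.ptCoord (z.map π₂ h₂) ∈ S →
      ramificationIndex π₁ h₁ z = ramificationIndex π₂ h₂ z)
    (hTe : ∀ z : Points K d, C.ptCoord (z.map π₁ h₁) ∈ T → C.ptCoord (z.map π₂ h₂) ∈ T →
      ramificationIndex π₁ h₁ z = ramificationIndex π₂ h₂ z) :
    ∃ c : K, c ≠ 0 ∧ ∀ z : Points K d, z.1 (IsLocalRing.closedPoint K) ∈ U → ∀ a b : Option K,
      a = C.ptCoord (z.map π₁ h₁) → b = C.ptCoord (z.map π₂ h₂) →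
      form (RingHom.id K) S m (homX a) (homY a) * form (RingHom.id K) T n (homX b) (homY b) =
        c * (form (RingHom.id K) S m (homX b) (homY b) *
          form (RingHom.id K) T n (homX a) (homY a)) := by
  have hp : IsProper (U.ι ≫ d) := isProper_ι_comp U hU
  have hint : IsIntegral (baseChange K (U.ι ≫ d)) := isIntegral_baseChange U
  have hsm : SmoothOfRelativeDimension 1 (pullback.snd d (specMap k K)) := smooth_snd
  have hpr : IsProper (pullback.snd (U.ι ≫ d) (specMap k K)) :=
    MorphismProperty.IsStableUnderBaseChange.of_isPullback
      (IsPullback.of_hasPullback (U.ι ≫ d) (specMap k K)) inferInstance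
  let j := baseChangeMap K U.ι (rfl : U.ι ≫ d = U.ι ≫ d)
  let C' := C.baseChange K q
  let f := pullback.snd (U.ι ≫ d) (specMap k K)
  have hj : j ≫ pullback.snd d (specMap k K) = f := baseChangeMap_snd _ _
  have comp : ∀ (π : X ⟶ P) (h : π ≫ q = d), baseChangeMap K (U.ι ≫ π)
      (by rw [Category.assoc, h] : (U.ι ≫ π) ≫ q = U.ι ≫ d) = j ≫ baseChangeMap K π h :=
    fun π h => baseChangeMap_comp U.ι rfl π h _
  have coord : ∀ (π : X ⟶ P) (h : π ≫ q = d) (w : Points K (U.ι ≫ d)),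
      C'.coord ((w.lift ≫ j) ≫ baseChangeMap K π h) = C.ptCoord ((w.map U.ι rfl).map π h) := by
    intro π h w
    rw [LineChart.ptCoord, Points.lift_map, Points.lift_map]
  have ne : ∀ (π : X ⟶ P) (h : π ≫ q = d) [IsDominant (U.ι ≫ π)] (c : Option K),
      ∃ a, lin (scalStalk f a) c (C'.pullX (j ≫ baseChangeMap K π h) a)
        (C'.pullY (j ≫ baseChangeMap K π h) a) ≠ 0 := by
    intro π h _ c
    rw [← comp π h]
    exact exists_lin_ne_zero C (U.ι ≫ π) _ c
  have mapForm : ∀ (π : X ⟶ P) (h : π ≫ q = d) (S : Finset (Option K)) (m : ℕ)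
      (a : baseChange K (U.ι ≫ d)),
      (j.stalkMap a) (form (scalStalk (pullback.snd d (specMap k K)) (j a)) S m
        (C'.pullX (baseChangeMap K π h) (j a)) (C'.pullY (baseChangeMap K π h) (j a))) =
      form (scalStalk f a) S m (C'.pullX (j ≫ baseChangeMap K π h) a)
        (C'.pullY (j ≫ baseChangeMap K π h) a) := by
    intro π h S m a
    rw [LineChart.pullX_comp, LineChart.pullY_comp]
    exact map_form _ _ (j.stalkMap a).hom (stalkMap_scalStalk j hj a) S m _ _
  -- Ramification indices live on `X_K`, which need not be integral, so nonvanishing is proved on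
  -- the component and pulled back through `j`.
  have ne' : ∀ (π : X ⟶ P) (h : π ≫ q = d) [IsDominant (U.ι ≫ π)] (c : Option K)
      (a : baseChange K (U.ι ≫ d)),
      lin (scalStalk (pullback.snd d (specMap k K)) (j a)) c
        (C'.pullX (baseChangeMap K π h) (j a)) (C'.pullY (baseChangeMap K π h) (j a)) ≠ 0 := by
    intro π h _ c a h0
    have h1 := C'.form_ne_zero f (j ≫ baseChangeMap K π h) (ne π h) a {c} 1
    rw [← mapForm] at h1
    refine h1 ?_
    simp only [form, Finset.prod_singleton, pow_one]
    exact (congrArg _ h0).trans (map_zero (j.stalkMap a).hom)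
  have assoc : ∀ (S : Finset (Option K)) (m : ℕ)
      (_ : ∀ z : Points K d, C.ptCoord (z.map π₁ h₁) ∈ S ↔ C.ptCoord (z.map π₂ h₂) ∈ S)
      (_ : ∀ z : Points K d, C.ptCoord (z.map π₁ h₁) ∈ S → C.ptCoord (z.map π₂ h₂) ∈ S →
        ramificationIndex π₁ h₁ z = ramificationIndex π₂ h₂ z)
      (a : baseChange K (U.ι ≫ d)), IsClosed {a} →
      Associated (form (scalStalk f a) S m (C'.pullX (j ≫ baseChangeMap K π₁ h₁) a)
        (C'.pullY (j ≫ baseChangeMap K π₁ h₁) a))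
        (form (scalStalk f a) S m (C'.pullX (j ≫ baseChangeMap K π₂ h₂) a)
        (C'.pullY (j ≫ baseChangeMap K π₂ h₂) a)) := by
    intro S m hS hSe a ha
    obtain ⟨w, rfl⟩ := Points.exists_toBaseChange_eq ha
    have hs : (w.lift ≫ j) ≫ pullback.snd d (specMap k K) = 𝟙 _ := by
      rw [Category.assoc, hj, Points.lift_snd]
    have h := C'.associated_form (baseChangeMap K π₁ h₁) (w.lift ≫ j) hs (baseChangeMap K π₂ h₂)
      (baseChangeMap_snd _ _) (baseChangeMap_snd _ _) S m (fun c => ne' π₁ h₁ c _)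
      (fun c => ne' π₂ h₂ c _) (by rw [coord, coord]; exact hS _) (by
        intro hS1 hS2
        rw [coord] at hS1 hS2
        have h3 := hSe _ hS1 hS2
        have h4 : (w.map U.ι rfl).lift = w.lift ≫ j := Points.lift_map _ _ _
        rw [← h4]
        exact h3)
    rw [← mapForm, ← mapForm]
    exact h.map (j.stalkMap w.toBaseChange).hom
  obtain ⟨c, hc0, hc⟩ := C'.exists_form_mul_eq f (j ≫ baseChangeMap K π₁ h₁)
    (j ≫ baseChangeMap K π₂ h₂) (ne π₁ h₁) (ne π₂ h₂) S T m n hd (assoc S m hS hSe)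
    (assoc T n hT hTe)
  refine ⟨c, hc0, ?_⟩
  rintro z hz a b rfl rfl
  -- The point factors through the open component, where the identity of germs can be evaluated.
  obtain ⟨w, rfl⟩ : ∃ w : Points K (U.ι ≫ d), w.map U.ι rfl = z := by
    have hr : Set.range z.1 ⊆ Set.range U.ι := by
      rintro _ ⟨y, rfl⟩
      have : y = IsLocalRing.closedPoint K := Subsingleton.elim (α := PrimeSpectrum K) _ _
      simpa [this] using hz
    refine ⟨⟨IsOpenImmersion.lift U.ι z.1 hr, ?_⟩, Subtype.ext (IsOpenImmersion.lift_fac _ _ _)⟩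
    rw [IsOpenImmersion.lift_fac_assoc, z.2]
  have h := congrArg (Scheme.stalkClosedPointTo w.lift).hom (hc w.toBaseChange)
  have h' := ((map_mul (Scheme.stalkClosedPointTo w.lift).hom _ _).symm.trans h).trans
    ((map_mul (Scheme.stalkClosedPointTo w.lift).hom _ _).trans
      (congrArg (_ * ·) (map_mul (Scheme.stalkClosedPointTo w.lift).hom _ _)))
  have hev : ∀ (π : X ⟶ P) (h : π ≫ q = d) (S : Finset (Option K)) (m : ℕ),
      (Scheme.stalkClosedPointTo w.lift).hom (form (scalStalk f w.toBaseChange) S m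
        (C'.pullX (j ≫ baseChangeMap K π h) w.toBaseChange)
        (C'.pullY (j ≫ baseChangeMap K π h) w.toBaseChange)) =
      form (RingHom.id K) S m (homX (C.ptCoord ((w.map U.ι rfl).map π h)))
        (homY (C.ptCoord ((w.map U.ι rfl).map π h))) := by
    intro π h S m
    rw [← coord, Category.assoc]
    exact C'.ev_form (j ≫ baseChangeMap K π h) w.lift w.lift_snd
      (by rw [Category.assoc, baseChangeMap_snd, hj]) S m
  have hcc := stalkClosedPointTo_scalStalk w.lift w.lift_snd c
  refine Eq.trans (congrArg₂ (· * ·) (hev _ _ _ _) (hev _ _ _ _)).symm (h'.trans ?_)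
  exact congrArg₂ (· * ·) hcc (congrArg₂ (· * ·) (hev _ _ _ _) (hev _ _ _ _))

end Component

/-! ### Irreducible complete sets and almost invariant functions -/

section Combinatorics

/-- An irreducible complete set of the correspondence with source map `s` and target map `t`. -/
abbrev IsIrredComplete {Z Q : Type*} (s t : Z → Q) (A : Set Q) : Prop :=
  Minimal (fun T : Set Q => T.Nonempty ∧ s ⁻¹' T = t ⁻¹' T) A

variable {Z Q K I : Type*} [Field K] {s t : Z → Q}

/-- The intersection of complete sets is complete, so minimality of `A` forces `A ∩ B = A`. -/
lemma IsIrredComplete.subset {A B : Set Q} (hA : IsIrredComplete s t A)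
    (hB : s ⁻¹' B = t ⁻¹' B) (h : (A ∩ B).Nonempty) : A ⊆ B := by
  have h1 : A ⊆ A ∩ B := hA.2 ⟨h, by rw [Set.preimage_inter, Set.preimage_inter, hA.1.2, hB]⟩
    Set.inter_subset_left
  exact h1.trans Set.inter_subset_right

lemma IsIrredComplete.eq_or_disjoint {A B : Set Q} (hA : IsIrredComplete s t A)
    (hB : IsIrredComplete s t B) : A = B ∨ Disjoint A B := by
  rw [Set.disjoint_iff_inter_eq_empty, or_iff_not_imp_right, ← Ne, ← Set.nonempty_iff_ne_empty]
  intro h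
  exact (hA.subset hB.1.2 h).antisymm (hB.subset hA.1.2 (Set.inter_comm A B ▸ h))

/-- A correspondence with a function `F / G` which is invariant up to constants, and which has
two irreducible complete sets as sets of zeros and poles. -/
lemma eq_or_eq_of_not_finitary [Finite I] (π : Z → I → Prop) (hπ : ∀ z, ∃ i, π z i)
    (ht : ∀ i p, ∃ z, π z i ∧ t z = p) {S S' : Set Q} (hS : IsIrredComplete s t S)
    (hS' : IsIrredComplete s t S') (hSf : S.Finite) (hSf' : S'.Finite) (F G : Q → K)
    (hF : ∀ p, F p = 0 ↔ p ∈ S) (hG : ∀ p, G p = 0 ↔ p ∈ S') (c : I → K) (hc : ∀ i, c i ≠ 0)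
    (hFG : ∀ z i, π z i → F (s z) * G (t z) = c i * (F (t z) * G (s z)))
    (hfib : ∀ N, N ≠ 0 → ∃ M : ℕ, ∀ v, v ≠ 0 → {p | F p ^ N = v * G p ^ N}.encard ≤ M)
    (hfin : ¬ ∃ M : ℕ, ∀ A, IsIrredComplete s t A → A.encard ≤ M)
    {T : Set Q} (hT : IsIrredComplete s t T) (hTf : T.Finite) : T = S ∨ T = S' := by
  have hmem : ∀ z, s z ∈ S ↔ t z ∈ S := fun z => Set.ext_iff.mp hS.1.2 z
  have hmem' : ∀ z, s z ∈ S' ↔ t z ∈ S' := fun z => Set.ext_iff.mp hS'.1.2 z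
  have hdiv : ∀ z i, π z i → s z ∉ S' → F (s z) / G (s z) = c i * (F (t z) / G (t z)) := by
    intro z i hi h
    have h1 : G (s z) ≠ 0 := fun e => h ((hG _).mp e)
    have h2 : G (t z) ≠ 0 := fun e => h ((hmem' z).mpr ((hG _).mp e))
    rw [← mul_div_assoc, div_eq_div_iff h1 h2, hFG z i hi, mul_assoc]
  by_contra! hne
  have hd : Disjoint T S := (hT.eq_or_disjoint hS).resolve_left hne.1
  have hd' : Disjoint T S' := (hT.eq_or_disjoint hS').resolve_left hne.2
  by_cases hroot : ∀ i, ∃ n, n ≠ 0 ∧ c i ^ n = 1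
  · choose n hn0 hn using hroot
    have := Fintype.ofFinite I
    obtain ⟨M, hM⟩ := hfib (∏ i, n i) (Finset.prod_ne_zero_iff.mpr fun i _ => hn0 i)
    have hN : ∀ i, c i ^ (∏ i, n i) = 1 := fun i => by
      obtain ⟨m, hm⟩ := Finset.dvd_prod_of_mem n (Finset.mem_univ i)
      rw [hm, pow_mul, hn, one_pow]
    refine hfin ⟨max M (max S.ncard S'.ncard), fun A hA => ?_⟩
    rcases hA.eq_or_disjoint hS with rfl | hAS
    · rw [← hSf.cast_ncard_eq]
      exact_mod_cast (le_max_left _ _).trans (le_max_right _ _)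
    rcases hA.eq_or_disjoint hS' with rfl | hAS'
    · rw [← hSf'.cast_ncard_eq]
      exact_mod_cast (le_max_right _ _).trans (le_max_right _ _)
    obtain ⟨p, hp⟩ := hA.1.1
    have hpS : F p ≠ 0 := fun e => hAS.notMem_of_mem_left hp ((hF _).mp e)
    have hpS' : G p ≠ 0 := fun e => hAS'.notMem_of_mem_left hp ((hG _).mp e)
    -- As `c i ^ N = 1`, the fibre of `(F / G) ^ N` outside `S'` is complete; it meets `A`, so it
    -- contains `A`.
    have hAB : A ⊆ {p' | p' ∉ S' ∧ (F p' / G p') ^ (∏ i, n i) = (F p / G p) ^ (∏ i, n i)} := by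
      refine hA.subset (Set.ext fun z => ?_) ⟨p, hp, hAS'.notMem_of_mem_left hp, rfl⟩
      obtain ⟨i, hi⟩ := hπ z
      change (_ ∉ S' ∧ _) ↔ (_ ∉ S' ∧ _)
      rw [← hmem' z]
      refine and_congr_right fun h => ?_
      rw [hdiv z i hi h, mul_pow, hN, one_mul]
    refine (Set.encard_le_encard (hAB.trans ?_)).trans
      ((hM ((F p / G p) ^ (∏ i, n i)) (pow_ne_zero _ (div_ne_zero hpS hpS'))).trans
        (by exact_mod_cast le_max_left _ _))
    rintro p' ⟨h1, h2⟩
    rw [Set.mem_ofPred_eq, ← h2, div_pow, div_mul_cancel₀]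
    exact pow_ne_zero _ fun e => h1 ((hG _).mp e)
  · push Not at hroot
    obtain ⟨i, hi⟩ := hroot
    obtain ⟨p, hp⟩ := hT.1.1
    -- Lifting a point of `T` through `t` to the `i`-th piece and applying `s` stays in `T` and
    -- multiplies `F / G` by `c i`.
    have hV : ∀ n : ℕ, c i ^ n * (F p / G p) ∈ (fun p => F p / G p) '' T := by
      intro n
      induction n with
      | zero => exact ⟨p, hp, by simp⟩
      | succ n ih =>
        obtain ⟨p', hp', h⟩ := ih
        obtain ⟨z, hz, rfl⟩ := ht i p'
        have hsz : s z ∈ T := (Set.ext_iff.mp hT.1.2 z).mpr hp'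
        refine ⟨s z, hsz, ?_⟩
        change F (s z) / G (s z) = _
        rw [hdiv z i hz (hd'.notMem_of_mem_left hsz), pow_succ', mul_assoc, ← h]
    have hv : F p / G p ≠ 0 := div_ne_zero (fun e => hd.notMem_of_mem_left hp ((hF _).mp e))
      (fun e => hd'.notMem_of_mem_left hp ((hG _).mp e))
    refine Set.infinite_of_injective_forall_mem (f := fun n : ℕ => c i ^ n * (F p / G p)) ?_ hV
      (hTf.image _)
    intro a b hab
    have hab' : c i ^ a = c i ^ b := mul_right_cancel₀ hv hab
    have key : ∀ a b : ℕ, a < b → c i ^ a ≠ c i ^ b := by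
      intro a b hlt he
      obtain ⟨m, rfl⟩ := Nat.exists_eq_add_of_lt hlt
      rw [add_assoc, pow_add] at he
      exact hi (m + 1) (Nat.succ_ne_zero m)
        (mul_left_cancel₀ (pow_ne_zero a (hc i)) (he.symm.trans (mul_one _).symm))
    rcases lt_trichotomy a b with h | h | h
    · exact absurd hab' (key a b h)
    · exact h
    · exact absurd hab'.symm (key b a h)

end Combinatorics

/-! ### Uniform bound on the fibres of powers of `F / G` -/

section Fibres

variable {K : Type*} [Field K]

/-- In the affine coordinate a fibre is the zero set of a polynomial of degree bounded independently
of `v`. It is nonzero because exactly one of the two forms vanishes at `a`. -/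
lemma exists_encard_le_of_form (S T : Finset (Option K)) (m n N : ℕ) (hm : m ≠ 0) (hn : n ≠ 0)
    (hN : N ≠ 0) (hST : Disjoint S T) (a : K) (ha : some a ∈ S ∨ some a ∈ T) :
    ∃ M : ℕ, ∀ v : K, v ≠ 0 →
      {p : Option K | form (RingHom.id K) S m (homX p) (homY p) ^ N =
        v * form (RingHom.id K) T n (homX p) (homY p) ^ N}.encard ≤ M := by
  classical
  let A : Polynomial K := form Polynomial.C S m 1 Polynomial.X
  let B : Polynomial K := form Polynomial.C T n 1 Polynomial.X
  have hev : ∀ (S : Finset (Option K)) (m : ℕ) (b : K),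
      (form Polynomial.C S m 1 Polynomial.X).eval b =
        form (RingHom.id K) S m (homX (some b)) (homY (some b)) := by
    intro S m b
    refine (map_form _ (RingHom.id K) (Polynomial.evalRingHom b) (fun a => ?_) S m _ _).trans ?_
    · simp
    · simp [homX, homY]
  -- The extra `1` accounts for the point at infinity.
  refine ⟨max (A ^ N).natDegree (B ^ N).natDegree + 1, fun v hv => ?_⟩
  let R : Polynomial K := A ^ N - Polynomial.C v * B ^ N
  have hR : R ≠ 0 := by
    intro h0
    have h1 := congrArg (Polynomial.eval a) h0
    simp only [R, A, B, Polynomial.eval_sub, Polynomial.eval_mul, Polynomial.eval_pow,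
      Polynomial.eval_C, hev, Polynomial.eval_zero] at h1
    rcases ha with ha | ha
    · have h2 := fun e => Finset.disjoint_left.mp hST ha ((form_hom_eq_zero_iff T hn _).mp e)
      rw [(form_hom_eq_zero_iff S hm _).mpr ha, zero_pow hN, zero_sub, neg_eq_zero] at h1
      exact mul_ne_zero hv (pow_ne_zero N h2) h1
    · have h2 := fun e => Finset.disjoint_right.mp hST ha ((form_hom_eq_zero_iff S hm _).mp e)
      rw [(form_hom_eq_zero_iff T hn _).mpr ha, zero_pow hN, mul_zero, sub_zero] at h1
      exact pow_ne_zero N h2 h1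
  have hdeg : R.natDegree ≤ max (A ^ N).natDegree (B ^ N).natDegree :=
    (Polynomial.natDegree_sub_le _ _).trans
      (max_le_max le_rfl (Polynomial.natDegree_C_mul_le _ _))
  have hsub : {p : Option K | form (RingHom.id K) S m (homX p) (homY p) ^ N =
        v * form (RingHom.id K) T n (homX p) (homY p) ^ N} ⊆
      ((insert none (R.roots.toFinset.image some) : Finset (Option K)) : Set (Option K)) := by
    rintro (_ | b) hb
    · simp
    · have : R.IsRoot b := by
        simp only [R, A, B, Polynomial.IsRoot, Polynomial.eval_sub, Polynomial.eval_mul,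
          Polynomial.eval_pow, Polynomial.eval_C, hev]
        exact sub_eq_zero.mpr hb
      simp [hR, this.eq_zero]
  refine (Set.encard_le_encard hsub).trans ?_
  rw [Set.encard_coe_eq_coe_finsetCard]
  have h1 : (insert none (R.roots.toFinset.image some) : Finset (Option K)).card ≤
      R.natDegree + 1 := by
    refine (Finset.card_insert_le _ _).trans (Nat.add_le_add_right ?_ 1)
    exact Finset.card_image_le.trans ((Multiset.toFinset_card_le _).trans
      (Polynomial.card_roots' R))
  exact_mod_cast h1.trans (Nat.add_le_add_right hdeg 1)

end Fibres

/-! ### Conclusion for self-correspondences -/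

/-- Over a projective line, if a non-finitary self-correspondence has two irreducible finite
equiramified complete sets, there is no other irreducible finite complete set. -/
theorem eq_or_eq_of_isEquiramified {k : Type u} [Field k] {K : Type u} [Field K] [Algebra k K]
    [IsAlgClosed K] {P : Scheme.{u}} {q : P ⟶ SpecOf k} [IsProper q] (C : LineChart q)
    (D : SelfCorrespondence q) (hD : ¬ D.IsFinitary K) {S S' T : Set (Points K q)}
    (hS : D.IsIrreducibleComplete S) (hSf : S.Finite) (hSe : D.IsEquiramified S)
    (hS' : D.IsIrreducibleComplete S') (hSf' : S'.Finite) (hSe' : D.IsEquiramified S')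
    (hne : S ≠ S') (hT : D.IsIrreducibleComplete T) (hTf : T.Finite) : T = S ∨ T = S' := by
  classical
  have hd : Disjoint S S' := (IsIrredComplete.eq_or_disjoint hS hS').resolve_left hne
  obtain ⟨p₁, hp₁⟩ := hS.1.1
  obtain ⟨p₂, hp₂⟩ := hS'.1.1
  have hp : p₁ ≠ p₂ := fun h => Set.disjoint_left.mp hd hp₁ (h ▸ hp₂)
  have : Nontrivial (Points K q) := ⟨p₁, p₂, hp⟩
  have hpr := D.isProper
  have hsm := D.smooth
  have hinj := C.ptCoord_injective (K := K)
  let κ : Points K q → Option K := C.ptCoord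
  let A : Finset (Option K) := hSf.toFinset.image κ
  let B : Finset (Option K) := hSf'.toFinset.image κ
  have hA : ∀ p, κ p ∈ A ↔ p ∈ S := fun p => by simp [A, κ, hinj.eq_iff]
  have hB : ∀ p, κ p ∈ B ↔ p ∈ S' := fun p => by simp [B, κ, hinj.eq_iff]
  have hA0 : A.card ≠ 0 := Finset.card_ne_zero_of_mem ((hA p₁).mpr hp₁)
  have hB0 : B.card ≠ 0 := Finset.card_ne_zero_of_mem ((hB p₂).mpr hp₂)
  have hAB : Disjoint A B := by
    rw [Finset.disjoint_left]
    intro a ha hb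
    obtain ⟨p, -, rfl⟩ := Finset.mem_image.mp ha
    exact Set.disjoint_left.mp hd ((hA p).mp ha) ((hB p).mp hb)
  -- The distinct points `p₁` and `p₂` cannot both be at infinity.
  obtain ⟨a, ha⟩ : ∃ a, some a ∈ A ∨ some a ∈ B := by
    rcases h₁ : κ p₁ with _ | a
    · rcases h₂ : κ p₂ with _ | a
      · exact absurd (hinj (h₁.trans h₂.symm)) hp
      · exact ⟨a, Or.inr (h₂ ▸ (hB p₂).mpr hp₂)⟩
    · exact ⟨a, Or.inl (h₁ ▸ (hA p₁).mpr hp₁)⟩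
  -- The exponents are crossed, `B.card` on `A` and `A.card` on `B`, so that both forms have degree
  -- `A.card * B.card`.
  have hconst : ∀ x : D.D, ∃ c : K, c ≠ 0 ∧ ∀ z : Points K D.d,
      z.1 (IsLocalRing.closedPoint K) ∈ connectedComponent x → ∀ a b : Option K,
      a = κ (D.src z) → b = κ (D.tgt z) →
      form (RingHom.id K) A B.card (homX a) (homY a) *
          form (RingHom.id K) B A.card (homX b) (homY b) =
        c * (form (RingHom.id K) A B.card (homX b) (homY b) *
          form (RingHom.id K) B A.card (homX a) (homY a)) := by
    intro x
    obtain ⟨U, hU, hg, h₁, h₂⟩ := D.component x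
    have := h₁.isDominant
    have := h₂.isDominant
    rw [← hU]
    exact exists_form_eq_of_component C D.π₁ D.π₂ D.π₁_comp D.π₂_comp U
      (hU ▸ isClosed_connectedComponent) A B B.card A.card (mul_comm _ _)
      (fun z => ((hA _).trans (Set.ext_iff.mp hS.1.2 z)).trans (hA _).symm)
      (fun z => ((hB _).trans (Set.ext_iff.mp hS'.1.2 z)).trans (hB _).symm)
      (fun z h h' => hSe z ((hA _).mp h) ((hA _).mp h'))
      (fun z h h' => hSe' z ((hB _).mp h) ((hB _).mp h'))
  choose c hc0 hc using hconst
  have hsurj : ∀ (x : D.D) (p : Points K q), ∃ z : Points K D.d,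
      z.1 (IsLocalRing.closedPoint K) ∈ connectedComponent x ∧ D.tgt z = p := by
    intro x p
    obtain ⟨U, hU, hg, h₁, h₂⟩ := D.component x
    have := h₂.isDominant
    have hpU : IsProper (U.ι ≫ D.d) := isProper_ι_comp U (hU ▸ isClosed_connectedComponent)
    obtain ⟨w, rfl⟩ := Points.map_surjective (K := K) (U.ι ≫ D.π₂)
      (by rw [Category.assoc, D.π₂_comp] : (U.ι ≫ D.π₂) ≫ q = U.ι ≫ D.d) p
    refine ⟨w.map U.ι rfl, ?_, Subtype.ext (Category.assoc _ _ _)⟩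
    rw [← hU]
    exact (w.1 (IsLocalRing.closedPoint K)).2
  have hcpt : CompactSpace D.D := (quasiCompact_iff_compactSpace D.d).mp inferInstance
  have hopen : ∀ x : D.D, IsOpen (connectedComponent x) := fun x => by
    obtain ⟨U, hU, -⟩ := D.component x
    exact hU ▸ U.2
  -- Components are open and `D` is quasi-compact, so finitely many constants suffice.
  obtain ⟨I, hI⟩ := isCompact_univ.elim_finite_subcover (fun x : D.D => connectedComponent x)
    hopen (fun x _ => Set.mem_iUnion.mpr ⟨x, mem_connectedComponent⟩)
  refine eq_or_eq_of_not_finitary (I := I) (s := D.src) (t := D.tgt)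
    (fun z x => z.1 (IsLocalRing.closedPoint K) ∈ connectedComponent x.1) (fun z => ?_)
    (fun x p => hsurj x p) hS hS' hSf hSf'
    (fun p => form (RingHom.id K) A B.card (homX (κ p)) (homY (κ p)))
    (fun p => form (RingHom.id K) B A.card (homX (κ p)) (homY (κ p)))
    (fun p => (form_hom_eq_zero_iff A hB0 _).trans (hA p))
    (fun p => (form_hom_eq_zero_iff B hA0 _).trans (hB p)) (fun x => c x.1) (fun x => hc0 x.1)
    (fun z x hz => hc x.1 z hz _ _ rfl rfl) (fun N hN => ?_) hD hT hTf
  · obtain ⟨x, hx, hz⟩ := Set.mem_iUnion₂.mp (hI (Set.mem_univ (z.1 (IsLocalRing.closedPoint K))))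
    exact ⟨⟨x, hx⟩, hz⟩
  · obtain ⟨M, hM⟩ := exists_encard_le_of_form A B B.card A.card N hB0 hA0 hN hAB a ha
    refine ⟨M, fun v hv => le_trans ?_ (hM v hv)⟩
    exact Set.encard_le_encard_of_injOn (f := κ) (fun p hp => hp) hinj.injOn

end SelfCorr

end

theorem mainTheorem7 (k : Type u) [Field k] (K : Type u) [Field K] [Algebra k K]
    [IsAlgClosure k K] (D : SelfCorrespondence (SelfCorr.projectiveLineToSpec k))
    (hD : ¬ D.IsFinitary K) :
    {S : Set (SelfCorr.Points K (SelfCorr.projectiveLineToSpec k)) |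
        D.IsIrreducibleComplete S ∧ S.Finite ∧ D.IsEquiramified S}.encard ≤ 2 ∧
      ∀ S S' : Set (SelfCorr.Points K (SelfCorr.projectiveLineToSpec k)),
        D.IsIrreducibleComplete S → S.Finite → D.IsEquiramified S →
        D.IsIrreducibleComplete S' → S'.Finite → D.IsEquiramified S' →
        S ≠ S' →
        ∀ T : Set (SelfCorr.Points K (SelfCorr.projectiveLineToSpec k)),
          D.IsIrreducibleComplete T → T.Finite → T = S ∨ T = S' := by
  have : IsAlgClosed K := IsAlgClosure.isAlgClosed k
  refine ⟨?_, fun S S' hS hSf hSe hS' hSf' hSe' hne T hT hTf =>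
    SelfCorr.eq_or_eq_of_isEquiramified (SelfCorr.projChart k) D hD hS hSf hSe hS' hSf' hSe' hne
      hT hTf⟩
  by_cases h : {S : Set (SelfCorr.Points K (SelfCorr.projectiveLineToSpec k)) |
      D.IsIrreducibleComplete S ∧ S.Finite ∧ D.IsEquiramified S}.Subsingleton
  · exact (Set.encard_le_one_iff_subsingleton.mpr h).trans (by norm_num)
  · rw [Set.not_subsingleton_iff] at h
    obtain ⟨S, hS, S', hS', hne⟩ := h
    refine (Set.encard_le_encard (t := {S, S'}) fun T hT => ?_).trans (Set.encard_pair hne).le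
    exact SelfCorr.eq_or_eq_of_isEquiramified (SelfCorr.projChart k) D hD hS.1 hS.2.1 hS.2.2 hS'.1
      hS'.2.1 hS'.2.2 hne hT.1 hT.2.1
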